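/- **Setting.** Let $T$ and $M$ be smooth manifolds, $\dim T=p\ge 1$, $\dim M=n$, with local coordinates $(t^\alpha)$ and $(x^i)$. Let $J^1(T,M)\to T\times M$ be the first jet bundle, with induced coordinates $(t^\alpha,x^i,x^i_\alpha)$. Greek indices run from $1$ to $p$, Latin ones from $1$ to $n$, and repeated indices are summed. Let $h=(h_{\alpha\beta}(t))$ be a semi-Riemannian metric on $T$. Let $ML^n_p=(J^1(T,M),L)$ be a metrical multi-time Lagrange space. This means that $L:J^1(T,M)\to\mathbb R$ is smooth and that in all local coordinates $$G^{(\alpha)(\beta)}_{(i)(j)}:=\tfrac12\frac{\partial^2L}{\partial x^i_\alpha\partial x^j_\beta}=h^{\alpha\beta}(t)\,g_{ij}(t,x,x^k_\gamma)$$ for a smooth symmetric d-tensor $g_{ij}$ on $J^1(T,M)$ of rank $n$ and constant signature. Here $(h^{\alpha\beta})$ and $(g^{ij})$ are the inverse matrices of $(h_{\alpha\beta})$ and $(g_{ij})$. If $p=1$, write $t=t^1$ and $y^i=x^i_1$. **Canonical nonlinear connection.** Let $H^\gamma_{\alpha\beta}$ be the Christoffel symbols of $h$, and let $$\Gamma^i_{jk}=\tfrac{g^{im}}2\Big(\frac{\partial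 g_{mj}}{\partial x^k}+\frac{\partial g_{mk}}{\partial x^j}-\frac{\partial g_{jk}}{\partial x^m}\Big).$$ Put $M^{(i)}_{(\alpha)\beta}=-H^\gamma_{\alpha\beta}x^i_\gamma$. * For $p=1$, put $N^{(i)}_{(1)j}=h_{11}\,\partial\mathcal G^i/\partial y^j$ with $$\mathcal G^i=\tfrac{g^{ik}}4\Big(\frac{\partial^2L}{\partial x^j\partial y^k}y^j-\frac{\partial L}{\partial x^k}+\frac{\partial^2L}{\partial t\,\partial y^k}+\frac{\partial L}{\partial y^k}H^1_{11}+2h^{11}H^1_{11}g_{kl}y^l\Big).$$ * For $p\ge2$, put $$N^{(i)}_{(\alpha)j}=\Gamma^i_{jk}x^k_\alpha+\tfrac{g^{ik}}2\frac{\partial g_{jk}}{\partial t^\alpha}+\tfrac{g^{ik}}4h_{\alpha\beta}U^{(\beta)}_{(k)j},\qquad U^{(\beta)}_{(k)j}=\frac{\partial U^{(\beta)}_{(k)}}{\partial x^j}-\frac{\partial U^{(\beta)}_{(j)}}{\partial x^k},$$ where $U^{(\alpha)}_{(i)}(t,x)$ is the value of $\partial L/\partial x^i_\alpha$ at $x^k_\gamma=0$.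 (For $p\ge 2$ one has $L=h^{\alpha\beta}g_{ij}(t,x)x^i_\alpha x^j_\beta+U^{(\alpha)}_{(i)}(t,x)x^i_\alpha+\Phi(t,x)$ for a function $\Phi$.) Set $\frac{\delta}{\delta t^\beta}=\frac{\partial}{\partial t^\beta}-M^{(i)}_{(\alpha)\beta}\frac{\partial}{\partial x^i_\alpha}$ and $\frac{\delta}{\delta x^j}=\frac{\partial}{\partial x^j}-N^{(i)}_{(\alpha)j}\frac{\partial}{\partial x^i_\alpha}$. **Cartan canonical connection.** It is $C\Gamma=(H^\gamma_{\alpha\beta},G^k_{j\gamma},L^i_{jk},C^{i(\gamma)}_{j(k)})$ with $$G^k_{j\gamma}=\tfrac{g^{ki}}2\frac{\delta g_{ij}}{\delta t^\gamma},\qquad L^i_{jk}=\tfrac{g^{im}}2\Big(\frac{\delta g_{mj}}{\delta x^k}+\frac{\delta g_{mk}}{\delta x^j}-\frac{\delta g_{jk}}{\delta x^m}\Big),\qquad C^{i(\gamma)}_{j(k)}=\tfrac{g^{im}}2\Big(\frac{\partial g_{mj}}{\partial x^k_\gamma}+\frac{\partial g_{mk}}{\partial x^j_\gamma}-\frac{\partial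 g_{jk}}{\partial x^m_\gamma}\Big).$$ Its local covariant derivatives ${}_{/\beta}$, ${}_{|k}$ and $|^{(\gamma)}_{(k)}$ start from $\delta/\delta t^\beta$, $\delta/\delta x^k$ and $\partial/\partial x^k_\gamma$ respectively. For ${}_{/\beta}$, temporal indices are differentiated with $H$ and spatial ones with $G$. For ${}_{|k}$ and $|^{(\gamma)}_{(k)}$, spatial indices are differentiated with $L$ and $C$ respectively, and temporal indices give no term. For example, $$Y^{(\alpha)}_{(i)j/\beta}=\frac{\delta Y^{(\alpha)}_{(i)j}}{\delta t^\beta}+H^\alpha_{\gamma\beta}Y^{(\gamma)}_{(i)j}-G^m_{i\beta}Y^{(\alpha)}_{(m)j}-G^m_{j\beta}Y^{(\alpha)}_{(i)m},\qquad Y^{(\alpha)}_{(i)j|k}=\frac{\delta Y^{(\alpha)}_{(i)j}}{\delta x^k}-L^m_{ik}Y^{(\alpha)}_{(m)j}-L^m_{jk}Y^{(\alpha)}_{(i)m}.$$ **Torsion and deflection.** Put $$T^m_{\beta j}=-G^m_{j\beta},\qquad R^{(m)}_{(\mu)\beta k}=\frac{\delta M^{(m)}_{(\mu)\beta}}{\delta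 x^k}-\frac{\delta N^{(m)}_{(\mu)k}}{\delta t^\beta},\qquad R^{(m)}_{(\mu)jk}=\frac{\delta N^{(m)}_{(\mu)j}}{\delta x^k}-\frac{\delta N^{(m)}_{(\mu)k}}{\delta x^j},$$ $$x^{(\alpha)}_{(i)}=G^{(\alpha)(\gamma)}_{(i)(k)}x^k_\gamma,\qquad \bar D^{(\alpha)}_{(i)\beta}=x^{(\alpha)}_{(i)/\beta},\qquad D^{(\alpha)}_{(i)j}=x^{(\alpha)}_{(i)|j},\qquad d^{(\alpha)(\beta)}_{(i)(j)}=x^{(\alpha)}_{(i)}|^{(\beta)}_{(j)}.$$ The horizontal electromagnetic components are $F^{(\alpha)}_{(i)j}=\tfrac12\big(D^{(\alpha)}_{(i)j}-D^{(\alpha)}_{(j)i}\big)$. Below, $\mathcal A_{\{i,k\}}$ means the expression minus the one with $i,k$ interchanged, and $\sum_{\{i,j,k\}}$ is the cyclic sum. **Theorem (Maxwell equations).** In all local coordinates and for all values of the free indices: 1. $\displaystyle F^{(\alpha)}_{(i)k/\beta}=\tfrac12\mathcal A_{\{i,k\}}\Big\{\bar D^{(\alpha)}_{(i)\beta|k}+D^{(\alpha)}_{(i)m}T^m_{\beta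 k}+d^{(\alpha)(\mu)}_{(i)(m)}R^{(m)}_{(\mu)\beta k}-\big[T^r_{\beta i|k}+C^{r(\mu)}_{k(m)}R^{(m)}_{(\mu)\beta i}\big]x^{(\alpha)}_{(r)}\Big\}$. 2. If $p=1$, then $$\sum_{\{i,j,k\}}F^{(1)}_{(i)j|k}=-\sum_{\{i,j,k\}}C^{(1)(1)(1)}_{(i)(l)(m)}R^{(m)}_{(1)jk}\,y^l,\qquad\text{where } C^{(1)(1)(1)}_{(i)(l)(m)}:=G^{(1)(1)}_{(l)(q)}C^{q(1)}_{i(m)}=\tfrac14\frac{\partial^3L}{\partial y^i\partial y^l\partial y^m}.$$ If $p\ge2$, then $\displaystyle\sum_{\{i,j,k\}}F^{(\alpha)}_{(i)j|k}=0$. 3. $\displaystyle\sum_{\{i,j,k\}}F^{(\alpha)}_{(i)j}|^{(\gamma)}_{(k)}=0$. -/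

import Mathlib

open scoped Manifold ContDiff

noncomputable section

namespace MultiTime

/-! ### The 1-jet space and its local coordinates -/

/-- The points of the jet bundle `J¹(T, M) → T × M`: a point `t` of `T`, a point `x` of `M` and a
linear map `T_t T → T_x M` (the differential at `t` of a map `T → M` sending `t` to `x`). -/
structure Jet1 (p n : ℕ) (T M : Type*)
    [TopologicalSpace T] [ChartedSpace (EuclideanSpace ℝ (Fin p)) T]
    [TopologicalSpace M] [ChartedSpace (EuclideanSpace ℝ (Fin n)) M] where
  t : T
  x : M
  map : TangentSpace (𝓡 p) t →L[ℝ] TangentSpace (𝓡 n) x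

/-- The coordinate space of `J¹(T, M)`; a point is `(t^α, x^i, x^i_α)`, the last component
being the function `fun i α => x^i_α`. -/
abbrev Coord (p n : ℕ) : Type :=
  EuclideanSpace ℝ (Fin p) × EuclideanSpace ℝ (Fin n) × (Fin n → Fin p → ℝ)

section Charts

variable {p n : ℕ} {T M : Type*}
  [TopologicalSpace T] [ChartedSpace (EuclideanSpace ℝ (Fin p)) T]
  [TopologicalSpace M] [ChartedSpace (EuclideanSpace ℝ (Fin n)) M]

/-- The set of coordinates of the chart of `J¹(T, M)` induced by the charts `φ` and `ψ`. -/
def jetDomain (φ : OpenPartialHomeomorph T (EuclideanSpace ℝ (Fin p)))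
    (ψ : OpenPartialHomeomorph M (EuclideanSpace ℝ (Fin n))) : Set (Coord p n) :=
  {z | z.1 ∈ φ.target ∧ z.2.1 ∈ ψ.target}

/-- The coordinate vector `∂/∂u^i` of a chart at the point with coordinates `u`. -/
def coordVec {m : ℕ} {N : Type*} [TopologicalSpace N] [ChartedSpace (EuclideanSpace ℝ (Fin m)) N]
    (φ : OpenPartialHomeomorph N (EuclideanSpace ℝ (Fin m)))
    (u : EuclideanSpace ℝ (Fin m)) (i : Fin m) : TangentSpace (𝓡 m) (φ.symm u) :=
  mfderiv (𝓡 m) (𝓡 m) φ.symm u (EuclideanSpace.single i (1 : ℝ) : EuclideanSpace ℝ (Fin m))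

/-- The jet with coordinates `(t^α, x^i, x^i_α)`: its linear map is
`∑ x^i_α dt^α ⊗ ∂/∂x^i`, that is `dψ⁻¹ ∘ (x^i_α) ∘ dφ`. -/
def jetOfCoord (φ : OpenPartialHomeomorph T (EuclideanSpace ℝ (Fin p)))
    (ψ : OpenPartialHomeomorph M (EuclideanSpace ℝ (Fin n))) (z : Coord p n) : Jet1 p n T M where
  t := φ.symm z.1
  x := ψ.symm z.2.1
  map := (mfderiv (𝓡 n) (𝓡 n) ψ.symm z.2.1).comp
    ((LinearMap.toContinuousLinearMap (Matrix.toEuclideanLin (Matrix.of z.2.2))).comp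
      (mfderiv (𝓡 p) (𝓡 p) φ (φ.symm z.1)))

end Charts

/-! ### Partial derivatives in jet coordinates -/

section Partial

variable {p n : ℕ}

/-- `∂f/∂t^α` for a function of `t` only. -/
def dtime (α : Fin p) (f : EuclideanSpace ℝ (Fin p) → ℝ) (t : EuclideanSpace ℝ (Fin p)) : ℝ :=
  fderiv ℝ f t (EuclideanSpace.single α 1)

/-- `∂f/∂t^α`. -/
def dt (α : Fin p) (f : Coord p n → ℝ) (z : Coord p n) : ℝ :=
  fderiv ℝ f z (EuclideanSpace.single α 1, 0, 0)

/-- `∂f/∂x^i`. -/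
def dx (i : Fin n) (f : Coord p n → ℝ) (z : Coord p n) : ℝ :=
  fderiv ℝ f z (0, EuclideanSpace.single i 1, 0)

/-- `∂f/∂x^i_α`. -/
def dv (i : Fin n) (α : Fin p) (f : Coord p n → ℝ) (z : Coord p n) : ℝ :=
  fderiv ℝ f z (0, 0, Pi.single i (Pi.single α 1))

end Partial

/-- Local coordinate expressions of a Lagrangian function `L(t^γ, x^k, x^k_γ)`, a temporal metric
`h_{αβ}(t^γ)` and a spatial metrical d-tensor `g_{ij}(t^γ, x^k, x^k_γ)`. -/
structure LocalData (p n : ℕ) where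
  L : Coord p n → ℝ
  h : EuclideanSpace ℝ (Fin p) → Matrix (Fin p) (Fin p) ℝ
  g : Coord p n → Matrix (Fin n) (Fin n) ℝ

/-! ### Metrical multi-time Lagrange spaces -/

section Spaces

variable (p n : ℕ) (T M : Type*)
  [TopologicalSpace T] [ChartedSpace (EuclideanSpace ℝ (Fin p)) T]
  [TopologicalSpace M] [ChartedSpace (EuclideanSpace ℝ (Fin n)) M]

/-- A smooth semi-Riemannian metric on `T`: a smooth field of symmetric nondegenerate bilinear
forms of constant index on the tangent spaces. -/
structure SemiRiemannianMetric where
  form : ∀ t : T, LinearMap.BilinForm ℝ (TangentSpace (𝓡 p) t)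
  symm : ∀ t, (form t).IsSymm
  nondegenerate : ∀ t, (form t).Nondegenerate
  index_const : ∃ r : ℕ, ∀ t, sigNeg (form t).toQuadraticMap = r
  smooth : ∀ φ ∈ IsManifold.maximalAtlas (𝓡 p) ∞ T, ∀ α β : Fin p,
    ContDiffOn ℝ ∞ (fun u => form (φ.symm u) (coordVec φ u α) (coordVec φ u β)) φ.target

/-- The data on which a metrical multi-time Lagrange space is built: a semi-Riemannian metric `h`
on `T`, a smooth function `L` on `J¹(T, M)`, and a d-tensor `g_{ij}` on `J¹(T, M)`, i.e. a smooth
assignment to every jet of a bilinear form on the tangent space of `M` at its base point, which is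
symmetric, of rank `n` and of constant signature. Smoothness is expressed in all charts of
`J¹(T, M)` induced by charts of `T` and `M`. -/
structure JetLagrangian where
  h : SemiRiemannianMetric p T
  L : Jet1 p n T M → ℝ
  g : ∀ e : Jet1 p n T M, LinearMap.BilinForm ℝ (TangentSpace (𝓡 n) e.x)
  g_symm : ∀ e, (g e).IsSymm
  g_nondegenerate : ∀ e, (g e).Nondegenerate
  g_index_const : ∃ r : ℕ, ∀ e, sigNeg (g e).toQuadraticMap = r
  L_smooth : ∀ φ ∈ IsManifold.maximalAtlas (𝓡 p) ∞ T, ∀ ψ ∈ IsManifold.maximalAtlas (𝓡 n) ∞ M,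
    ContDiffOn ℝ ∞ (fun z => L (jetOfCoord φ ψ z)) (jetDomain φ ψ)
  g_smooth : ∀ φ ∈ IsManifold.maximalAtlas (𝓡 p) ∞ T, ∀ ψ ∈ IsManifold.maximalAtlas (𝓡 n) ∞ M,
    ∀ i j : Fin n, ContDiffOn ℝ ∞
      (fun z : Coord p n =>
        g (jetOfCoord φ ψ z) (coordVec ψ z.2.1 i) (coordVec ψ z.2.1 j)) (jetDomain φ ψ)

variable {p n T M}

/-- The local expressions of `L`, `h_{αβ}` and `g_{ij}` in the coordinates given by `φ` and `ψ`. -/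
def JetLagrangian.inCharts (S : JetLagrangian p n T M)
    (φ : OpenPartialHomeomorph T (EuclideanSpace ℝ (Fin p)))
    (ψ : OpenPartialHomeomorph M (EuclideanSpace ℝ (Fin n))) : LocalData p n where
  L := fun z => S.L (jetOfCoord φ ψ z)
  h := fun u => Matrix.of fun α β => S.h.form (φ.symm u) (coordVec φ u α) (coordVec φ u β)
  g := fun z => Matrix.of fun i j =>
    S.g (jetOfCoord φ ψ z) (coordVec ψ z.2.1 i) (coordVec ψ z.2.1 j)

end Spaces

namespace LocalData

variable {p n : ℕ} (D : LocalData p n)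

/-- `h^{αβ}`, the inverse matrix of `h_{αβ}`. -/
def hInv (α β : Fin p) (t : EuclideanSpace ℝ (Fin p)) : ℝ := (D.h t)⁻¹ α β

/-- `g^{ij}`, the inverse matrix of `g_{ij}`. -/
def gInv (i j : Fin n) (z : Coord p n) : ℝ := (D.g z)⁻¹ i j

/-- The vertical fundamental metrical d-tensor
`G^{(α)(β)}_{(i)(j)} = ½ ∂²L / ∂x^i_α ∂x^j_β`. -/
def G (α β : Fin p) (i j : Fin n) (z : Coord p n) : ℝ :=
  1 / 2 * dv i α (dv j β D.L) z

/-- The Christoffel symbols `H^γ_{αβ}` of the temporal metric. -/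
def H (γ α β : Fin p) (t : EuclideanSpace ℝ (Fin p)) : ℝ :=
  ∑ η, D.hInv γ η t / 2 *
    (dtime β (fun u => D.h u η α) t + dtime α (fun u => D.h u η β) t
      - dtime η (fun u => D.h u α β) t)

/-- The generalized Christoffel symbols `Γ^i_{jk}` of the spatial metrical d-tensor. -/
def Γ (i j k : Fin n) (z : Coord p n) : ℝ :=
  ∑ m, D.gInv i m z / 2 *
    (dx k (fun w => D.g w m j) z + dx j (fun w => D.g w m k) z - dx m (fun w => D.g w j k) z)

/-! #### The canonical nonlinear connection -/

/-- `M^{(i)}_{(α)β} = - H^γ_{αβ} x^i_γ`. -/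
def M (i : Fin n) (α β : Fin p) (z : Coord p n) : ℝ :=
  - ∑ γ, D.H γ α β z.1 * z.2.2 i γ

/-- The functions `𝒢^i` used for `p = 1`, where `α` stands for the only temporal index `1` and
`x^i_α` for `y^i`:
`𝒢^i = (g^{ik}/4) (∂²L/∂x^j∂y^k y^j - ∂L/∂x^k + ∂²L/∂t∂y^k + ∂L/∂y^k H^1_{11}
+ 2 h^{11} H^1_{11} g_{kl} y^l)`. -/
def spray (α : Fin p) (i : Fin n) (z : Coord p n) : ℝ :=
  ∑ k, D.gInv i k z / 4 *
    ((∑ j, dx j (dv k α D.L) z * z.2.2 j α) - dx k D.L z + dt α (dv k α D.L) z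
      + dv k α D.L z * D.H α α α z.1
      + 2 * D.hInv α α z.1 * D.H α α α z.1 * ∑ l, D.g z k l * z.2.2 l α)

/-- `U^{(α)}_{(i)}(t, x)`, the coefficient of `x^i_α` in the expression
`L = h^{αβ} g_{ij}(t, x) x^i_α x^j_β + U^{(α)}_{(i)}(t, x) x^i_α + F(t, x)` which `L` has for
`p ≥ 2`: the value of `∂L/∂x^i_α` at `x^k_γ = 0`. -/
def U (α : Fin p) (i : Fin n) (z : Coord p n) : ℝ := dv i α D.L (z.1, z.2.1, 0)

/-- `U^{(α)}_{(i)j} = ∂U^{(α)}_{(i)}/∂x^j - ∂U^{(α)}_{(j)}/∂x^i`. -/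
def curlU (α : Fin p) (i j : Fin n) (z : Coord p n) : ℝ :=
  dx j (D.U α i) z - dx i (D.U α j) z

/-- The spatial components `N^{(i)}_{(α)j}` of the canonical nonlinear connection:
`h_{11} ∂𝒢^i/∂y^j` for `p = 1`, and
`Γ^i_{jk} x^k_α + (g^{ik}/2) ∂g_{jk}/∂t^α + (g^{ik}/4) h_{αβ} U^{(β)}_{(k)j}` for `p ≥ 2`. -/
def N (i : Fin n) (α : Fin p) (j : Fin n) (z : Coord p n) : ℝ :=
  if p = 1 then D.h z.1 α α * dv j α (D.spray α i) z
  else (∑ k, D.Γ i j k z * z.2.2 k α)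
    + (∑ k, D.gInv i k z / 2 * dt α (fun w => D.g w j k) z)
    + ∑ k, ∑ β, D.gInv i k z / 4 * D.h z.1 α β * D.curlU β k j z

/-- `δ/δt^β = ∂/∂t^β - M^{(i)}_{(α)β} ∂/∂x^i_α`. -/
def deltaT (β : Fin p) (f : Coord p n → ℝ) (z : Coord p n) : ℝ :=
  dt β f z - ∑ i, ∑ α, D.M i α β z * dv i α f z

/-- `δ/δx^j = ∂/∂x^j - N^{(i)}_{(α)j} ∂/∂x^i_α`. -/
def deltaX (j : Fin n) (f : Coord p n → ℝ) (z : Coord p n) : ℝ :=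
  dx j f z - ∑ i, ∑ α, D.N i α j z * dv i α f z

/-! #### The Cartan canonical connection `CΓ = (H^γ_{αβ}, G^k_{jγ}, L^i_{jk}, C^{i(γ)}_{j(k)})` -/

/-- `G^k_{jγ} = (g^{ki}/2) δg_{ij}/δt^γ`. -/
def cG (k j : Fin n) (γ : Fin p) (z : Coord p n) : ℝ :=
  ∑ i, D.gInv k i z / 2 * D.deltaT γ (fun w => D.g w i j) z

/-- `L^i_{jk} = (g^{im}/2) (δg_{mj}/δx^k + δg_{mk}/δx^j - δg_{jk}/δx^m)`. -/
def cL (i j k : Fin n) (z : Coord p n) : ℝ :=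
  ∑ m, D.gInv i m z / 2 *
    (D.deltaX k (fun w => D.g w m j) z + D.deltaX j (fun w => D.g w m k) z
      - D.deltaX m (fun w => D.g w j k) z)

/-- `C^{i(γ)}_{j(k)} = (g^{im}/2) (∂g_{mj}/∂x^k_γ + ∂g_{mk}/∂x^j_γ - ∂g_{jk}/∂x^m_γ)`. -/
def cC (i j : Fin n) (γ : Fin p) (k : Fin n) (z : Coord p n) : ℝ :=
  ∑ m, D.gInv i m z / 2 *
    (dv k γ (fun w => D.g w m j) z + dv j γ (fun w => D.g w m k) z
      - dv m γ (fun w => D.g w j k) z)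

/-! #### Local covariant derivatives of `CΓ`

The connection is `h`-normal: the index pair of a vertical component is differentiated with
`δ^β_α G^i_{jγ} - δ^i_j H^β_{αγ}`, `δ^β_α L^i_{jk}` and `δ^β_α C^{i(γ)}_{j(k)}`. In particular
temporal indices do not contribute to the derivatives `|k` and `|^{(γ)}_{(k)}`. -/

/-- `X^{(α)}_{(i)/β}`. -/
def covT (X : Fin p → Fin n → Coord p n → ℝ) (α : Fin p) (i : Fin n) (β : Fin p)
    (z : Coord p n) : ℝ :=
  D.deltaT β (X α i) z + (∑ γ, D.H α γ β z.1 * X γ i z) - ∑ m, D.cG m i β z * X α m z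

/-- `X^{(α)}_{(i)|k}`. -/
def covX (X : Fin p → Fin n → Coord p n → ℝ) (α : Fin p) (i k : Fin n) (z : Coord p n) : ℝ :=
  D.deltaX k (X α i) z - ∑ m, D.cL m i k z * X α m z

/-- `X^{(α)}_{(i)}|^{(β)}_{(j)}`. -/
def covV (X : Fin p → Fin n → Coord p n → ℝ) (α : Fin p) (i : Fin n) (β : Fin p) (j : Fin n)
    (z : Coord p n) : ℝ :=
  dv j β (X α i) z - ∑ m, D.cC m i β j z * X α m z

/-- `Y^{(α)}_{(i)j/β}`. -/
def covT₂ (Y : Fin p → Fin n → Fin n → Coord p n → ℝ) (α : Fin p) (i j : Fin n) (β : Fin p)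
    (z : Coord p n) : ℝ :=
  D.deltaT β (Y α i j) z + (∑ γ, D.H α γ β z.1 * Y γ i j z)
    - (∑ m, D.cG m i β z * Y α m j z) - ∑ m, D.cG m j β z * Y α i m z

/-- `Y^{(α)}_{(i)j|k}`. -/
def covX₂ (Y : Fin p → Fin n → Fin n → Coord p n → ℝ) (α : Fin p) (i j k : Fin n)
    (z : Coord p n) : ℝ :=
  D.deltaX k (Y α i j) z - (∑ m, D.cL m i k z * Y α m j z) - ∑ m, D.cL m j k z * Y α i m z

/-- `Y^{(α)}_{(i)j}|^{(γ)}_{(k)}`. -/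
def covV₂ (Y : Fin p → Fin n → Fin n → Coord p n → ℝ) (α : Fin p) (i j : Fin n) (γ : Fin p)
    (k : Fin n) (z : Coord p n) : ℝ :=
  dv k γ (Y α i j) z - (∑ m, D.cC m i γ k z * Y α m j z) - ∑ m, D.cC m j γ k z * Y α i m z

/-! #### Torsion -/

/-- `T^m_{βj} = - G^m_{jβ}`. -/
def torT (m : Fin n) (β : Fin p) (j : Fin n) (z : Coord p n) : ℝ := - D.cG m j β z

/-- `T^m_{βi|k}`. -/
def torTCovX (m : Fin n) (β : Fin p) (i k : Fin n) (z : Coord p n) : ℝ :=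
  D.deltaX k (D.torT m β i) z + (∑ l, D.cL m l k z * D.torT l β i z)
    - ∑ l, D.cL l i k z * D.torT m β l z

/-- `R^{(m)}_{(μ)βk} = δM^{(m)}_{(μ)β}/δx^k - δN^{(m)}_{(μ)k}/δt^β`, the vertical component of
the bracket `[δ/δt^β, δ/δx^k]`. -/
def torRT (m : Fin n) (μ β : Fin p) (k : Fin n) (z : Coord p n) : ℝ :=
  D.deltaX k (D.M m μ β) z - D.deltaT β (D.N m μ k) z

/-- `R^{(m)}_{(μ)jk} = δN^{(m)}_{(μ)j}/δx^k - δN^{(m)}_{(μ)k}/δx^j`, the vertical component of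
the bracket `[δ/δx^j, δ/δx^k]`. -/
def torRX (m : Fin n) (μ : Fin p) (j k : Fin n) (z : Coord p n) : ℝ :=
  D.deltaX k (D.N m μ j) z - D.deltaX j (D.N m μ k) z

/-! #### Metrical deflection d-tensors and the electromagnetic components -/

/-- `x^{(α)}_{(i)} = G^{(α)(γ)}_{(i)(k)} x^k_γ`. -/
def xLow (α : Fin p) (i : Fin n) (z : Coord p n) : ℝ :=
  ∑ k, ∑ γ, D.G α γ i k z * z.2.2 k γ

/-- `D̄^{(α)}_{(i)β} = x^{(α)}_{(i)/β}`. -/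
def Dbar (α : Fin p) (i : Fin n) (β : Fin p) (z : Coord p n) : ℝ := D.covT D.xLow α i β z

/-- `D^{(α)}_{(i)j} = x^{(α)}_{(i)|j}`. -/
def defl (α : Fin p) (i j : Fin n) (z : Coord p n) : ℝ := D.covX D.xLow α i j z

/-- `d^{(α)(β)}_{(i)(j)} = x^{(α)}_{(i)}|^{(β)}_{(j)}`. -/
def vdefl (α : Fin p) (i : Fin n) (β : Fin p) (j : Fin n) (z : Coord p n) : ℝ :=
  D.covV D.xLow α i β j z

/-- The horizontal electromagnetic components
`F^{(α)}_{(i)j} = ½ (D^{(α)}_{(i)j} - D^{(α)}_{(j)i})`. -/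
def F (α : Fin p) (i j : Fin n) (z : Coord p n) : ℝ :=
  1 / 2 * (D.defl α i j z - D.defl α j i z)

/-- `C^{(α)(β)(γ)}_{(i)(l)(m)} = G^{(α)(β)}_{(l)(q)} C^{q(γ)}_{i(m)}`. -/
def Clow (α β γ : Fin p) (i l m : Fin n) (z : Coord p n) : ℝ :=
  ∑ q, D.G α β l q z * D.cC q i γ m z

/-- The expression in braces in the first Maxwell equation:
`D̄^{(α)}_{(i)β|k} + D^{(α)}_{(i)m} T^m_{βk} + d^{(α)(μ)}_{(i)(m)} R^{(m)}_{(μ)βk}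
- [T^r_{βi|k} + C^{r(μ)}_{k(m)} R^{(m)}_{(μ)βi}] x^{(α)}_{(r)}`. -/
def maxwellTerm (α β : Fin p) (i k : Fin n) (z : Coord p n) : ℝ :=
  D.covX (fun a l => D.Dbar a l β) α i k z
    + (∑ m, D.defl α i m z * D.torT m β k z)
    + (∑ m, ∑ μ, D.vdefl α i μ m z * D.torRT m μ β k z)
    - ∑ r, (D.torTCovX r β i k z + ∑ m, ∑ μ, D.cC r k μ m z * D.torRT m μ β i z) * D.xLow α r z

end LocalData

/-- A metrical multi-time Lagrange space `ML^n_p = (J¹(T, M), L)`: the Lagrangian function is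
Kronecker `h`-regular, i.e. in all local coordinates
`½ ∂²L/∂x^i_α ∂x^j_β = h^{αβ}(t^γ) g_{ij}(t^γ, x^k, x^k_γ)`. -/
structure LagrangeSpace (p n : ℕ) (T M : Type*)
    [TopologicalSpace T] [ChartedSpace (EuclideanSpace ℝ (Fin p)) T]
    [TopologicalSpace M] [ChartedSpace (EuclideanSpace ℝ (Fin n)) M]
    extends JetLagrangian p n T M where
  regular : ∀ φ ∈ IsManifold.maximalAtlas (𝓡 p) ∞ T, ∀ ψ ∈ IsManifold.maximalAtlas (𝓡 n) ∞ M,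
    ∀ z ∈ jetDomain φ ψ, ∀ (α β : Fin p) (i j : Fin n),
      (toJetLagrangian.inCharts φ ψ).G α β i j z
        = (toJetLagrangian.inCharts φ ψ).hInv α β z.1 * (toJetLagrangian.inCharts φ ψ).g z i j

/-- The cyclic sum `∑_{ {i,j,k} } A(i,j,k)`. -/
def cyclicSum {n : ℕ} (A : Fin n → Fin n → Fin n → ℝ) (i j k : Fin n) : ℝ :=
  A i j k + A j k i + A k i j

end MultiTime

end

/-! Everything is local, and the three equations are Bianchi-type identities for F. Since L^i_{jk}
is symmetric in j, k, the connection drops out of the alternation: F_{ij} = ½(δ_j x_i − δ_i x_j),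
where x_i is the lowered velocity (`F_eq`). The fields δ/δt^β and δ/δx^j have constant components
along ∂/∂t and ∂/∂x, so their brackets are vertical with the R's as coefficients
(`deltaT_deltaX_sub`, `deltaX_deltaX_sub`).

The first equation follows formally. Exchanging δ/δx^k and δ/δt^β in D̄_{|k} produces an R-term that
the d·R term absorbs. The remaining terms of the braces assemble into D_{(i)k} differentiated by /β,
plus a part symmetric in i, k which the alternation kills (`maxwellTerm_eq`, `maxwell_first`).

In the other two equations the L- and C-corrections cancel in the cyclic sum, leaving derivatives of
F itself.

For p = 1 the cyclic sum of δ_k F_{ij} is −½ times that of [δ_j, δ_k]x_i, and ∂x_i/∂y^m = G_{im} +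
2C_{ilm}y^l. The C-part is the right-hand side of the theorem. The cyclic sum of G_{im}R^m_{jk}
vanishes because the momenta p_i = ∂L/∂y^i satisfy δ_j p_i = δ_i p_j for the canonical connection
(`deltaX_dv_L_symm`, `cyclicSum_G_torRX`). The third equation uses the symmetry of ∂x_i/∂y^k and of
∂N^m_j/∂y^k, the latter because N^m_j is h_{11} times a y-gradient.

For p ≥ 2 Kronecker regularity forces g to be independent of the velocities (`dv_g_eq_zero`). Then F
= −¼ curl U with U a function of (t, x) (`F_eq_curlU`), so the second equation is the vanishing of
the cyclic derivative of a curl and the third is the vanishing of its vertical derivatives. -/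

open scoped Manifold ContDiff

noncomputable section

namespace MultiTime

/-! ### Directional derivatives along vector fields -/

section Along

variable {E : Type*} [NormedAddCommGroup E] [NormedSpace ℝ E]

/-- The derivative of `f` along the vector field `V`. -/
def along (V : E → E) (f : E → ℝ) (z : E) : ℝ := fderiv ℝ f z (V z)

variable {V W : E → E} {f g : E → ℝ} {U : Set E} {z : E}

theorem along_congr (hU : IsOpen U) (h : Set.EqOn f g U) (hz : z ∈ U) :
    along V f z = along V g z := by
  unfold along
  rw [(h.eventuallyEq_of_mem (hU.mem_nhds hz)).fderiv_eq]

theorem along_add (hf : DifferentiableAt ℝ f z) (hg : DifferentiableAt ℝ g z) :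
    along V (fun w => f w + g w) z = along V f z + along V g z := by
  simp [along, fderiv_fun_add hf hg]

theorem along_sub (hf : DifferentiableAt ℝ f z) (hg : DifferentiableAt ℝ g z) :
    along V (fun w => f w - g w) z = along V f z - along V g z := by
  simp [along, fderiv_fun_sub hf hg]

theorem along_mul (hf : DifferentiableAt ℝ f z) (hg : DifferentiableAt ℝ g z) :
    along V (fun w => f w * g w) z = f z * along V g z + along V f z * g z := by
  simp [along, fderiv_fun_mul hf hg, mul_comm]

theorem along_const_mul (c : ℝ) (hf : DifferentiableAt ℝ f z) :
    along V (fun w => c * f w) z = c * along V f z := by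
  simp [along, fderiv_const_mul hf]

theorem along_neg : along V (fun w => - f w) z = - along V f z := by
  simp [along, fderiv_fun_neg]

theorem along_const (c : ℝ) : along V (fun _ => c) z = 0 := by
  simp [along]

theorem along_sum {ι : Type*} {s : Finset ι} {f : ι → E → ℝ}
    (hf : ∀ i ∈ s, DifferentiableAt ℝ (f i) z) :
    along V (fun w => ∑ i ∈ s, f i w) z = ∑ i ∈ s, along V (f i) z := by
  simp [along, fderiv_fun_sum hf]

theorem along_eq_zero (hU : IsOpen U) {c : ℝ} (h : ∀ w ∈ U, f w = c) (hz : z ∈ U) :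
    along V f z = 0 := by
  rw [along_congr (g := fun _ => c) hU h hz, along_const]

theorem contDiffOn_along (hU : IsOpen U) (hV : ContDiffOn ℝ ∞ V U) (hf : ContDiffOn ℝ ∞ f U) :
    ContDiffOn ℝ ∞ (along V f) U :=
  (hf.fderiv_of_isOpen hU (m := ∞) (by simp)).clm_apply hV

/-- The second-derivative terms cancel by symmetry, so only the Lie bracket of the two fields acts
on `f`. -/
theorem along_along_sub (hU : IsOpen U) (hV : ContDiffOn ℝ ∞ V U) (hW : ContDiffOn ℝ ∞ W U)
    (hf : ContDiffOn ℝ ∞ f U) (hz : z ∈ U) :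
    along V (along W f) z - along W (along V f) z
      = fderiv ℝ f z (fderiv ℝ W z (V z) - fderiv ℝ V z (W z)) := by
  have hn := hU.mem_nhds hz
  have hd : DifferentiableAt ℝ (fderiv ℝ f) z :=
    ((hf.fderiv_of_isOpen hU (m := ∞) (by simp)).contDiffAt hn).differentiableAt (by simp)
  have hVd : DifferentiableAt ℝ V z := (hV.contDiffAt hn).differentiableAt (by simp)
  have hWd : DifferentiableAt ℝ W z := (hW.contDiffAt hn).differentiableAt (by simp)
  have hs : IsSymmSndFDerivAt ℝ f z := (hf.contDiffAt hn).isSymmSndFDerivAt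
    (by rw [minSmoothness_of_isRCLikeNormedField]; exact ENat.LEInfty.out)
  have e1 : along V (along W f) z
      = fderiv ℝ (fderiv ℝ f) z (V z) (W z) + fderiv ℝ f z (fderiv ℝ W z (V z)) := by
    have := fderiv_clm_apply hd hWd
    change fderiv ℝ (fun w => fderiv ℝ f w (W w)) z (V z) = _
    rw [this]; simp [add_comm]
  have e2 : along W (along V f) z
      = fderiv ℝ (fderiv ℝ f) z (W z) (V z) + fderiv ℝ f z (fderiv ℝ V z (W z)) := by
    have := fderiv_clm_apply hd hVd
    change fderiv ℝ (fun w => fderiv ℝ f w (V w)) z (W z) = _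
    rw [this]; simp [add_comm]
  rw [e1, e2, hs.eq (V z) (W z), map_sub]; ring

theorem along_const_comm (hU : IsOpen U) (v w : E) (hf : ContDiffOn ℝ ∞ f U) (hz : z ∈ U) :
    along (fun _ => v) (along (fun _ => w) f) z = along (fun _ => w) (along (fun _ => v) f) z := by
  have := along_along_sub hU (V := fun _ => v) (W := fun _ => w) contDiffOn_const
    contDiffOn_const hf hz
  simpa [sub_eq_zero] using this

end Along

/-! ### Coordinate fields and the adapted frame of the jet space -/

section Fields

variable {p n : ℕ}

/-- The coordinate vector `∂/∂t^α` of the jet coordinates. -/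
def vecTime (α : Fin p) : Coord p n := (EuclideanSpace.single α 1, 0, 0)

/-- The coordinate vector `∂/∂x^i` of the jet coordinates. -/
def vecSpace (i : Fin n) : Coord p n := (0, EuclideanSpace.single i 1, 0)

/-- The coordinate vector `∂/∂x^i_α` of the jet coordinates. -/
def vecFibre (i : Fin n) (α : Fin p) : Coord p n := (0, 0, Pi.single i (Pi.single α 1))

theorem dx_eq_along (i : Fin n) :
    (dx i : (Coord p n → ℝ) → Coord p n → ℝ) = along (fun _ => vecSpace i) := rfl

theorem dv_eq_along (i : Fin n) (α : Fin p) :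
    (dv i α : (Coord p n → ℝ) → Coord p n → ℝ) = along (fun _ => vecFibre i α) := rfl

namespace LocalData

variable (D : LocalData p n)

/-- The vector field `δ/δt^β`. -/
def vecT (β : Fin p) (z : Coord p n) : Coord p n :=
  vecTime β - ∑ i, ∑ α, D.M i α β z • vecFibre i α

/-- The vector field `δ/δx^j`. -/
def vecX (j : Fin n) (z : Coord p n) : Coord p n :=
  vecSpace j - ∑ i, ∑ α, D.N i α j z • vecFibre i α

theorem deltaT_eq_along (β : Fin p) : D.deltaT β = along (D.vecT β) := by
  funext f z
  simp only [along, vecT, map_sub, map_sum, map_smul, smul_eq_mul]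
  rfl

theorem deltaX_eq_along (j : Fin n) : D.deltaX j = along (D.vecX j) := by
  funext f z
  simp only [along, vecX, map_sub, map_sum, map_smul, smul_eq_mul]
  rfl

end LocalData

/-- Both families of the adapted frame have this form: a constant vector minus a vertical one. Hence
their derivatives, and with them their brackets, are vertical. -/
theorem fderiv_horizontal {c : Coord p n} {A : Fin n → Fin p → Coord p n → ℝ} {z : Coord p n}
    (hA : ∀ i α, DifferentiableAt ℝ (A i α) z) (v : Coord p n) :
    fderiv ℝ (fun w => c - ∑ i, ∑ α, A i α w • vecFibre i α) z v
      = - ∑ i, ∑ α, fderiv ℝ (A i α) z v • vecFibre i α := by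
  have h1 : ∀ i α, HasFDerivAt (fun w => A i α w • (vecFibre i α : Coord p n))
      ((fderiv ℝ (A i α) z).smulRight (vecFibre i α)) z :=
    fun i α => (hA i α).hasFDerivAt.smul_const _
  have h2 := (HasFDerivAt.fun_sum (u := Finset.univ) fun i _ =>
    HasFDerivAt.fun_sum (u := Finset.univ) fun α _ => h1 i α).const_sub c
  rw [h2.fderiv]; simp

/-- Coordinate functions `x^k_γ`. -/
theorem fderiv_fibre (k : Fin n) (γ : Fin p) (z v : Coord p n) :
    fderiv ℝ (fun w : Coord p n => w.2.2 k γ) z v = v.2.2 k γ := by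
  let ℓ : Coord p n →L[ℝ] ℝ := (ContinuousLinearMap.proj γ).comp
    ((ContinuousLinearMap.proj (R := ℝ) (φ := fun _ : Fin n => Fin p → ℝ) k).comp
      ((ContinuousLinearMap.snd ℝ _ _).comp (ContinuousLinearMap.snd ℝ _ _)))
  exact congrArg (· v) (ℓ.hasFDerivAt (x := z)).fderiv

theorem contDiff_fibre (k : Fin n) (γ : Fin p) :
    ContDiff ℝ ∞ (fun w : Coord p n => w.2.2 k γ) := by
  fun_prop

theorem along_vecSpace_fibre (i : Fin n) (k : Fin n) (γ : Fin p) (z : Coord p n) :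
    along (fun _ => vecSpace i) (fun w : Coord p n => w.2.2 k γ) z = 0 := by
  simp only [along, fderiv_fibre]; rfl

theorem vecFibre_apply (i k : Fin n) (α γ : Fin p) :
    (vecFibre i α : Coord p n).2.2 k γ = if k = i ∧ γ = α then 1 else 0 := by
  simp only [vecFibre, Pi.single_apply]
  by_cases h : k = i <;> simp [h, Pi.single_apply]

theorem along_vecFibre_fibre (i : Fin n) (α : Fin p) (k : Fin n) (γ : Fin p) (z : Coord p n) :
    along (fun _ => vecFibre i α) (fun w : Coord p n => w.2.2 k γ) z
      = if k = i ∧ γ = α then 1 else 0 := by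
  simp only [along, fderiv_fibre, vecFibre_apply]

theorem LocalData.along_vecX_fibre (D : LocalData p n) (j : Fin n) (k : Fin n) (γ : Fin p)
    (z : Coord p n) : along (D.vecX j) (fun w : Coord p n => w.2.2 k γ) z = - D.N k γ j z := by
  rw [← D.deltaX_eq_along, LocalData.deltaX, dx_eq_along, along_vecSpace_fibre]
  simp only [dv_eq_along, along_vecFibre_fibre]
  simp [ite_and, Finset.sum_ite_eq]

end Fields

/-! ### Local metrical multi-time Lagrange spaces -/

/-- The jet coordinates over a coordinate domain `V` of `T` and a coordinate domain `W` of `M`. -/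
def jetRegion {p n : ℕ} (V : Set (EuclideanSpace ℝ (Fin p)))
    (W : Set (EuclideanSpace ℝ (Fin n))) : Set (Coord p n) :=
  {z | z.1 ∈ V ∧ z.2.1 ∈ W}

namespace LocalData

variable {p n : ℕ}

/-- `D` consists of smooth functions over `V` and `W`, its metrics are nondegenerate, and its
Lagrangian function is Kronecker `h`-regular. -/
structure IsKroneckerOn (D : LocalData p n) (V : Set (EuclideanSpace ℝ (Fin p)))
    (W : Set (EuclideanSpace ℝ (Fin n))) : Prop where
  isOpen_time : IsOpen V
  isOpen_space : IsOpen W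
  L : ContDiffOn ℝ ∞ D.L (jetRegion V W)
  h : ∀ α β, ContDiffOn ℝ ∞ (fun u => D.h u α β) V
  g : ∀ i j, ContDiffOn ℝ ∞ (fun z => D.g z i j) (jetRegion V W)
  g_symm : ∀ z ∈ jetRegion V W, ∀ i j, D.g z i j = D.g z j i
  h_unit : ∀ u ∈ V, IsUnit (D.h u).det
  g_unit : ∀ z ∈ jetRegion V W, IsUnit (D.g z).det
  regular : ∀ z ∈ jetRegion V W, ∀ (α β : Fin p) (i j : Fin n),
    D.G α β i j z = D.hInv α β z.1 * D.g z i j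

end LocalData

/-- Cramer's rule: entries of the adjugate are determinants of matrices whose rows are smooth or
constant, and the determinant does not vanish. -/
theorem contDiffOn_matrix_inv {E ι : Type*} [NormedAddCommGroup E] [NormedSpace ℝ E] [Fintype ι]
    [DecidableEq ι] {A : E → Matrix ι ι ℝ} {U : Set E}
    (hA : ∀ i j, ContDiffOn ℝ ∞ (fun z => A z i j) U) (hdet : ∀ z ∈ U, IsUnit (A z).det)
    (i j : ι) : ContDiffOn ℝ ∞ (fun z => (A z)⁻¹ i j) U := by
  have hdetS : ∀ B : E → Matrix ι ι ℝ, (∀ i j, ContDiffOn ℝ ∞ (fun z => B z i j) U) →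
      ContDiffOn ℝ ∞ (fun z => (B z).det) U := by
    intro B hB
    simp only [Matrix.det_apply']
    exact ContDiffOn.sum fun σ _ => contDiffOn_const.mul (contDiffOn_prod fun k _ => hB _ _)
  have hadj : ContDiffOn ℝ ∞ (fun z => (A z).adjugate i j) U := by
    simp only [Matrix.adjugate_apply]
    refine hdetS _ fun k l => ?_
    by_cases hk : k = j
    · subst hk; simp only [Matrix.updateRow_self]; exact contDiffOn_const
    · simp only [Matrix.updateRow_ne hk]; exact hA k l
  have : (fun z => (A z)⁻¹ i j) = fun z => ((A z).det)⁻¹ * (A z).adjugate i j := by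
    funext z
    simp [Matrix.inv_def]
  rw [this]
  exact ((hdetS A hA).inv fun z hz => (hdet z hz).ne_zero).mul hadj

/-! ### Smoothness of the connection and of the tensors built from it -/

namespace LocalData.IsKroneckerOn

variable {p n : ℕ} {D : LocalData p n} {V : Set (EuclideanSpace ℝ (Fin p))}
  {W : Set (EuclideanSpace ℝ (Fin n))}

theorem isOpen (hD : D.IsKroneckerOn V W) : IsOpen (jetRegion V W) :=
  (hD.isOpen_time.preimage continuous_fst).inter
    (hD.isOpen_space.preimage (continuous_fst.comp continuous_snd))

theorem differentiableAt (hD : D.IsKroneckerOn V W) {F : Type*} [NormedAddCommGroup F]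
    [NormedSpace ℝ F] {f : Coord p n → F}
    (hf : ContDiffOn ℝ ∞ f (jetRegion V W)) {z : Coord p n} (hz : z ∈ jetRegion V W) :
    DifferentiableAt ℝ f z :=
  (hf.contDiffAt (hD.isOpen.mem_nhds hz)).differentiableAt (by simp)

theorem contDiffOn_dt (hD : D.IsKroneckerOn V W) {f : Coord p n → ℝ}
    (hf : ContDiffOn ℝ ∞ f (jetRegion V W)) (α : Fin p) :
    ContDiffOn ℝ ∞ (dt α f) (jetRegion V W) :=
  contDiffOn_along hD.isOpen contDiffOn_const hf

theorem contDiffOn_dx (hD : D.IsKroneckerOn V W) {f : Coord p n → ℝ}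
    (hf : ContDiffOn ℝ ∞ f (jetRegion V W)) (i : Fin n) :
    ContDiffOn ℝ ∞ (dx i f) (jetRegion V W) :=
  contDiffOn_along hD.isOpen contDiffOn_const hf

theorem contDiffOn_dv (hD : D.IsKroneckerOn V W) {f : Coord p n → ℝ}
    (hf : ContDiffOn ℝ ∞ f (jetRegion V W)) (i : Fin n) (α : Fin p) :
    ContDiffOn ℝ ∞ (dv i α f) (jetRegion V W) :=
  contDiffOn_along hD.isOpen contDiffOn_const hf

theorem contDiffOn_fibre (k : Fin n) (γ : Fin p) (U : Set (Coord p n)) :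
    ContDiffOn ℝ ∞ (fun w : Coord p n => w.2.2 k γ) U :=
  (contDiff_fibre k γ).contDiffOn

theorem comp_time {f : EuclideanSpace ℝ (Fin p) → ℝ}
    (hf : ContDiffOn ℝ ∞ f V) :
    ContDiffOn ℝ ∞ (fun z : Coord p n => f z.1) (jetRegion V W) :=
  hf.comp contDiff_fst.contDiffOn fun _ hz => hz.1

theorem contDiffOn_hInv (hD : D.IsKroneckerOn V W) (α β : Fin p) :
    ContDiffOn ℝ ∞ (D.hInv α β) V :=
  contDiffOn_matrix_inv hD.h hD.h_unit α β

theorem contDiffOn_gInv (hD : D.IsKroneckerOn V W) (i j : Fin n) :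
    ContDiffOn ℝ ∞ (D.gInv i j) (jetRegion V W) :=
  contDiffOn_matrix_inv hD.g hD.g_unit i j

theorem contDiffOn_H (hD : D.IsKroneckerOn V W) (γ α β : Fin p) :
    ContDiffOn ℝ ∞ (D.H γ α β) V := by
  have hd : ∀ α β γ : Fin p, ContDiffOn ℝ ∞ (dtime γ fun u => D.h u α β) V := fun α β γ =>
    contDiffOn_along hD.isOpen_time contDiffOn_const (hD.h α β)
  exact ContDiffOn.sum fun η _ => ((hD.contDiffOn_hInv _ _).div_const _).mul
    (((hd _ _ _).add (hd _ _ _)).sub (hd _ _ _))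

theorem contDiffOn_G (hD : D.IsKroneckerOn V W) (α β : Fin p) (i j : Fin n) :
    ContDiffOn ℝ ∞ (D.G α β i j) (jetRegion V W) :=
  contDiffOn_const.mul (hD.contDiffOn_dv (hD.contDiffOn_dv hD.L _ _) _ _)

theorem contDiffOn_Γ (hD : D.IsKroneckerOn V W) (i j k : Fin n) :
    ContDiffOn ℝ ∞ (D.Γ i j k) (jetRegion V W) :=
  ContDiffOn.sum fun _ _ => ((hD.contDiffOn_gInv _ _).div_const _).mul
    (((hD.contDiffOn_dx (hD.g _ _) _).add (hD.contDiffOn_dx (hD.g _ _) _)).sub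
      (hD.contDiffOn_dx (hD.g _ _) _))

theorem contDiffOn_M (hD : D.IsKroneckerOn V W) (i : Fin n) (α β : Fin p) :
    ContDiffOn ℝ ∞ (D.M i α β) (jetRegion V W) :=
  (ContDiffOn.sum fun _ _ => (comp_time (hD.contDiffOn_H _ _ _)).mul
    (contDiffOn_fibre _ _ _)).neg

/-- `g_{ik} 𝒢^k`, the lowered form of the functions `𝒢^i`. -/
def sprayLow (D : LocalData p n) (α : Fin p) (k : Fin n) (z : Coord p n) : ℝ :=
  1 / 4 * ((∑ j, dx j (dv k α D.L) z * z.2.2 j α) - dx k D.L z + dt α (dv k α D.L) z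
      + dv k α D.L z * D.H α α α z.1
      + 2 * D.hInv α α z.1 * D.H α α α z.1 * ∑ l, D.g z k l * z.2.2 l α)

theorem spray_eq (D : LocalData p n) (α : Fin p) (i : Fin n) (z : Coord p n) :
    D.spray α i z = ∑ k, D.gInv i k z * sprayLow D α k z :=
  Finset.sum_congr rfl fun k _ => by rw [sprayLow]; ring

theorem contDiffOn_sprayLow (hD : D.IsKroneckerOn V W) (α : Fin p) (k : Fin n) :
    ContDiffOn ℝ ∞ (sprayLow D α k) (jetRegion V W) := by
  have hH : ContDiffOn ℝ ∞ (fun z : Coord p n => D.H α α α z.1) (jetRegion V W) :=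
    comp_time (hD.contDiffOn_H _ _ _)
  have hh : ContDiffOn ℝ ∞ (fun z : Coord p n => D.hInv α α z.1) (jetRegion V W) :=
    comp_time (hD.contDiffOn_hInv _ _)
  have hv := hD.contDiffOn_dv hD.L k α
  exact contDiffOn_const.mul (((((ContDiffOn.sum fun j _ =>
    (hD.contDiffOn_dx hv j).mul (contDiffOn_fibre _ _ _)).sub (hD.contDiffOn_dx hD.L k)).add
    (hD.contDiffOn_dt hv α)).add (hv.mul hH)).add (((contDiffOn_const.mul hh).mul hH).mul
    (ContDiffOn.sum fun l _ => (hD.g k l).mul (contDiffOn_fibre _ _ _))))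

theorem contDiffOn_spray (hD : D.IsKroneckerOn V W) (α : Fin p) (i : Fin n) :
    ContDiffOn ℝ ∞ (D.spray α i) (jetRegion V W) := by
  rw [funext (spray_eq D α i)]
  exact ContDiffOn.sum fun k _ => (hD.contDiffOn_gInv _ _).mul (hD.contDiffOn_sprayLow _ _)

theorem contDiffOn_U (hD : D.IsKroneckerOn V W) (α : Fin p) (i : Fin n) :
    ContDiffOn ℝ ∞ (D.U α i) (jetRegion V W) := by
  have h0 : ContDiff ℝ ∞ (fun z : Coord p n => ((z.1, z.2.1, 0) : Coord p n)) := by fun_prop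
  -- The region puts no condition on the velocities, so setting them to zero stays inside it.
  exact (hD.contDiffOn_dv hD.L i α).comp h0.contDiffOn fun _ hz => hz

theorem contDiffOn_curlU (hD : D.IsKroneckerOn V W) (α : Fin p) (i j : Fin n) :
    ContDiffOn ℝ ∞ (D.curlU α i j) (jetRegion V W) :=
  (hD.contDiffOn_dx (hD.contDiffOn_U _ _) _).sub (hD.contDiffOn_dx (hD.contDiffOn_U _ _) _)

theorem contDiffOn_N (hD : D.IsKroneckerOn V W) (i : Fin n) (α : Fin p) (j : Fin n) :
    ContDiffOn ℝ ∞ (D.N i α j) (jetRegion V W) := by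
  unfold LocalData.N
  by_cases hp : p = 1
  · simp only [hp, if_true]
    exact (comp_time (hD.h α α)).mul (hD.contDiffOn_dv (hD.contDiffOn_spray _ _) _ _)
  · simp only [hp, if_false]
    exact ((ContDiffOn.sum fun k _ => (hD.contDiffOn_Γ _ _ _).mul (contDiffOn_fibre _ _ _)).add
      (ContDiffOn.sum fun k _ => ((hD.contDiffOn_gInv _ _).div_const _).mul
        (hD.contDiffOn_dt (hD.g _ _) _))).add
      (ContDiffOn.sum fun k _ => ContDiffOn.sum fun β _ =>
        (((hD.contDiffOn_gInv _ _).div_const _).mul (comp_time (hD.h α β))).mul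
          (hD.contDiffOn_curlU _ _ _))

theorem contDiffOn_vecT (hD : D.IsKroneckerOn V W) (β : Fin p) :
    ContDiffOn ℝ ∞ (D.vecT β) (jetRegion V W) :=
  contDiffOn_const.sub (ContDiffOn.sum fun _ _ => ContDiffOn.sum fun _ _ =>
    (hD.contDiffOn_M _ _ _).smul contDiffOn_const)

theorem contDiffOn_vecX (hD : D.IsKroneckerOn V W) (j : Fin n) :
    ContDiffOn ℝ ∞ (D.vecX j) (jetRegion V W) :=
  contDiffOn_const.sub (ContDiffOn.sum fun _ _ => ContDiffOn.sum fun _ _ =>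
    (hD.contDiffOn_N _ _ _).smul contDiffOn_const)

theorem contDiffOn_deltaT (hD : D.IsKroneckerOn V W) {f : Coord p n → ℝ}
    (hf : ContDiffOn ℝ ∞ f (jetRegion V W)) (β : Fin p) :
    ContDiffOn ℝ ∞ (D.deltaT β f) (jetRegion V W) := by
  rw [deltaT_eq_along]; exact contDiffOn_along hD.isOpen (hD.contDiffOn_vecT β) hf

theorem contDiffOn_deltaX (hD : D.IsKroneckerOn V W) {f : Coord p n → ℝ}
    (hf : ContDiffOn ℝ ∞ f (jetRegion V W)) (j : Fin n) :
    ContDiffOn ℝ ∞ (D.deltaX j f) (jetRegion V W) := by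
  rw [deltaX_eq_along]; exact contDiffOn_along hD.isOpen (hD.contDiffOn_vecX j) hf

theorem contDiffOn_cG (hD : D.IsKroneckerOn V W) (k j : Fin n) (γ : Fin p) :
    ContDiffOn ℝ ∞ (D.cG k j γ) (jetRegion V W) :=
  ContDiffOn.sum fun _ _ => ((hD.contDiffOn_gInv _ _).div_const _).mul
    (hD.contDiffOn_deltaT (hD.g _ _) _)

theorem contDiffOn_xLow (hD : D.IsKroneckerOn V W) (α : Fin p) (i : Fin n) :
    ContDiffOn ℝ ∞ (D.xLow α i) (jetRegion V W) :=
  ContDiffOn.sum fun _ _ => ContDiffOn.sum fun _ _ => (hD.contDiffOn_G _ _ _ _).mul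
    (contDiffOn_fibre _ _ _)

/-! #### Commutators of the adapted frame -/

/-- The bracket only differentiates the coefficients M and N of the vertical parts, and the
difference of these derivatives is R. -/
theorem deltaT_deltaX_sub (hD : D.IsKroneckerOn V W) {f : Coord p n → ℝ}
    (hf : ContDiffOn ℝ ∞ f (jetRegion V W)) (β : Fin p) (k : Fin n) {z : Coord p n}
    (hz : z ∈ jetRegion V W) :
    D.deltaT β (D.deltaX k f) z - D.deltaX k (D.deltaT β f) z
      = ∑ m, ∑ μ, dv m μ f z * D.torRT m μ β k z := by
  simp only [torRT, deltaT_eq_along, deltaX_eq_along]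
  rw [along_along_sub hD.isOpen (hD.contDiffOn_vecT β) (hD.contDiffOn_vecX k) hf hz]
  unfold vecT vecX
  rw [fderiv_horizontal fun i α => hD.differentiableAt (hD.contDiffOn_M i α β) hz,
    fderiv_horizontal fun i α => hD.differentiableAt (hD.contDiffOn_N i α k) hz]
  rw [neg_sub_neg, ← Finset.sum_sub_distrib]
  simp only [← Finset.sum_sub_distrib, ← sub_smul, map_sum, map_smul, smul_eq_mul]
  exact Finset.sum_congr rfl fun m _ => Finset.sum_congr rfl fun μ _ => mul_comm _ _

theorem deltaX_deltaX_sub (hD : D.IsKroneckerOn V W) {f : Coord p n → ℝ}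
    (hf : ContDiffOn ℝ ∞ f (jetRegion V W)) (j k : Fin n) {z : Coord p n}
    (hz : z ∈ jetRegion V W) :
    D.deltaX j (D.deltaX k f) z - D.deltaX k (D.deltaX j f) z
      = ∑ m, ∑ μ, dv m μ f z * D.torRX m μ j k z := by
  simp only [torRX, deltaX_eq_along]
  rw [along_along_sub hD.isOpen (hD.contDiffOn_vecX j) (hD.contDiffOn_vecX k) hf hz]
  unfold vecX
  rw [fderiv_horizontal fun i α => hD.differentiableAt (hD.contDiffOn_N i α j) hz,
    fderiv_horizontal fun i α => hD.differentiableAt (hD.contDiffOn_N i α k) hz]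
  rw [neg_sub_neg, ← Finset.sum_sub_distrib]
  simp only [← Finset.sum_sub_distrib, ← sub_smul, map_sum, map_smul, smul_eq_mul]
  exact Finset.sum_congr rfl fun m _ => Finset.sum_congr rfl fun μ _ => mul_comm _ _

end LocalData.IsKroneckerOn

namespace LocalData.IsKroneckerOn

variable {p n : ℕ} {D : LocalData p n} {V : Set (EuclideanSpace ℝ (Fin p))}
  {W : Set (EuclideanSpace ℝ (Fin n))} {z : Coord p n}

/-! ### The first Maxwell equation -/

theorem along_g_symm (hD : D.IsKroneckerOn V W) (hz : z ∈ jetRegion V W) (i j : Fin n)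
    (Y : Coord p n → Coord p n) :
    along Y (fun w => D.g w i j) z = along Y (fun w => D.g w j i) z :=
  along_congr hD.isOpen (fun w hw => hD.g_symm w hw i j) hz

theorem cL_symm (hD : D.IsKroneckerOn V W) (hz : z ∈ jetRegion V W) (i j k : Fin n) :
    D.cL i j k z = D.cL i k j z := by
  simp only [cL, deltaX_eq_along]
  refine Finset.sum_congr rfl fun m _ => ?_
  rw [hD.along_g_symm hz j k, add_comm (along _ _ _)]

/-- The terms L^m_{ij} x_m are symmetric in i, j and cancel, as in the torsion-free formula for an
exterior derivative. -/
theorem F_eq (hD : D.IsKroneckerOn V W) (hz : z ∈ jetRegion V W) (α : Fin p) (i j : Fin n) :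
    D.F α i j z = 1 / 2 * (D.deltaX j (D.xLow α i) z - D.deltaX i (D.xLow α j) z) := by
  simp only [F, defl, covX]
  simp only [hD.cL_symm hz _ j i]
  ring

theorem along_F (hD : D.IsKroneckerOn V W) (hz : z ∈ jetRegion V W) (α : Fin p) (i j : Fin n)
    (Y : Coord p n → Coord p n) :
    along Y (D.F α i j) z = 1 / 2 * (along Y (D.deltaX j (D.xLow α i)) z
      - along Y (D.deltaX i (D.xLow α j)) z) := by
  have hX : ∀ i j, DifferentiableAt ℝ (D.deltaX j (D.xLow α i)) z := fun i j =>
    hD.differentiableAt (hD.contDiffOn_deltaX (hD.contDiffOn_xLow _ _) _) hz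
  rw [along_congr hD.isOpen (fun w hw => hD.F_eq hw α i j) hz,
    along_const_mul _ ((hX i j).fun_sub (hX j i)), along_sub (hX i j) (hX j i)]

/-- Functions of t alone are constants for every field without a ∂/∂t component. This is what takes
H, h and h^{αβ} out of spatial and vertical derivatives. -/
theorem along_comp_time (hD : D.IsKroneckerOn V W) (hz : z ∈ jetRegion V W)
    {f : EuclideanSpace ℝ (Fin p) → ℝ} (hf : ContDiffOn ℝ ∞ f V) (Y : Coord p n → Coord p n)
    (hY : (Y z).1 = 0) : along Y (fun w => f w.1) z = 0 := by
  have h1 : DifferentiableAt ℝ f z.1 :=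
    (hf.contDiffAt (hD.isOpen_time.mem_nhds hz.1)).differentiableAt (by simp)
  have := (h1.hasFDerivAt.comp z (hasFDerivAt_fst (𝕜 := ℝ)
    (E := EuclideanSpace ℝ (Fin p)) (F := EuclideanSpace ℝ (Fin n) × (Fin n → Fin p → ℝ)))).fderiv
  change fderiv ℝ (f ∘ Prod.fst) z (Y z) = 0
  rw [this]; simp [hY]

theorem vecX_fst (D : LocalData p n) (j : Fin n) (z : Coord p n) : (D.vecX j z).1 = 0 := by
  simp [vecX, vecSpace, vecFibre, Prod.fst_sum]

theorem deltaX_Dbar (hD : D.IsKroneckerOn V W) (hz : z ∈ jetRegion V W) (α β : Fin p)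
    (i k : Fin n) :
    D.deltaX k (D.Dbar α i β) z = D.deltaX k (D.deltaT β (D.xLow α i)) z
      + (∑ γ, D.H α γ β z.1 * D.deltaX k (D.xLow γ i) z)
      - ((∑ m, D.cG m i β z * D.deltaX k (D.xLow α m) z)
        + ∑ m, D.deltaX k (D.cG m i β) z * D.xLow α m z) := by
  have hX : ∀ α i, DifferentiableAt ℝ (D.xLow α i) z := fun α i =>
    hD.differentiableAt (hD.contDiffOn_xLow α i) hz
  have hT : DifferentiableAt ℝ (D.deltaT β (D.xLow α i)) z :=
    hD.differentiableAt (hD.contDiffOn_deltaT (hD.contDiffOn_xLow _ _) _) hz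
  have hH : ∀ γ, DifferentiableAt ℝ (fun w : Coord p n => D.H α γ β w.1) z := fun γ =>
    hD.differentiableAt (comp_time (hD.contDiffOn_H _ _ _)) hz
  have hG : ∀ m, DifferentiableAt ℝ (D.cG m i β) z := fun m =>
    hD.differentiableAt (hD.contDiffOn_cG m i β) hz
  have hHX : DifferentiableAt ℝ (fun w : Coord p n => ∑ γ, D.H α γ β w.1 * D.xLow γ i w) z :=
    DifferentiableAt.fun_sum fun γ _ => (hH γ).fun_mul (hX γ i)
  have hGX : DifferentiableAt ℝ (fun w => ∑ m, D.cG m i β w * D.xLow α m w) z :=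
    DifferentiableAt.fun_sum fun m _ => (hG m).fun_mul (hX α m)
  rw [deltaX_eq_along]
  change along _ (fun w => D.deltaT β (D.xLow α i) w
    + (∑ γ, D.H α γ β w.1 * D.xLow γ i w) - ∑ m, D.cG m i β w * D.xLow α m w) z = _
  rw [along_sub (hT.fun_add hHX) hGX, along_add hT hHX, along_sum fun γ _ => (hH γ).fun_mul (hX γ i),
    along_sum fun m _ => (hG m).fun_mul (hX α m)]
  simp only [along_mul (hH _) (hX _ _), along_mul (hG _) (hX _ _),
    hD.along_comp_time hz (hD.contDiffOn_H _ _ _) _ (vecX_fst D k z), zero_mul, add_zero,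
    Finset.sum_add_distrib]

/-- The part of the braces of the first Maxwell equation which is symmetric in `i` and `k`. -/
def maxwellSymm (D : LocalData p n) (α β : Fin p) (i k : Fin n) (z : Coord p n) : ℝ :=
  - (∑ m, D.cL m i k z * D.Dbar α m β z)
    + (∑ r, (∑ l, D.cL l i k z * D.torT r β l z) * D.xLow α r z)
    - ∑ m, ∑ μ, ∑ r, (D.cC r i μ m z * D.torRT m μ β k z + D.cC r k μ m z * D.torRT m μ β i z)
        * D.xLow α r z

theorem maxwellSymm_comm (hD : D.IsKroneckerOn V W) (hz : z ∈ jetRegion V W) (α β : Fin p)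
    (i k : Fin n) : maxwellSymm D α β i k z = maxwellSymm D α β k i z := by
  simp only [maxwellSymm, hD.cL_symm hz _ i k]
  simp only [add_comm (D.cC _ i _ _ z * _)]

/-- The derivatives δ_k G^r_{iβ} coming from D̄ and from T_{|k} cancel, and G combines with L to
rebuild the deflections. The commutator absorbs the vertical derivative of x_i in d·R. What d leaves
over is a C·R term, whose mirror image under i ↔ k is the C·R term in the square bracket. -/
theorem maxwellTerm_eq (hD : D.IsKroneckerOn V W) (hz : z ∈ jetRegion V W) (α β : Fin p)
    (i k : Fin n) :
    D.maxwellTerm α β i k z = D.deltaT β (D.deltaX k (D.xLow α i)) z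
      + (∑ γ, D.H α γ β z.1 * D.deltaX k (D.xLow γ i) z)
      - (∑ m, D.cG m i β z * D.defl α m k z) - (∑ m, D.cG m k β z * D.defl α i m z)
      + maxwellSymm D α β i k z := by
  have hcomm := hD.deltaT_deltaX_sub (hD.contDiffOn_xLow α i) β k hz
  have hbar : D.covX (fun a l => D.Dbar a l β) α i k z
      = D.deltaX k (D.Dbar α i β) z - ∑ m, D.cL m i k z * D.Dbar α m β z := rfl
  have htor : ∀ r, D.deltaX k (D.torT r β i) z = - D.deltaX k (D.cG r i β) z := by
    intro r
    rw [deltaX_eq_along]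
    exact along_neg
  have hdefl : (∑ m, D.defl α i m z * D.torT m β k z) = - ∑ m, D.cG m k β z * D.defl α i m z := by
    rw [← Finset.sum_neg_distrib]
    exact Finset.sum_congr rfl fun m _ => by rw [torT]; ring
  have hv : (∑ m, ∑ μ, D.vdefl α i μ m z * D.torRT m μ β k z)
      = (∑ m, ∑ μ, dv m μ (D.xLow α i) z * D.torRT m μ β k z)
        - ∑ m, ∑ μ, ∑ r, D.cC r i μ m z * D.torRT m μ β k z * D.xLow α r z := by
    simp only [← Finset.sum_sub_distrib]
    refine Finset.sum_congr rfl fun m _ => Finset.sum_congr rfl fun μ _ => ?_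
    rw [vdefl, covV, sub_mul, Finset.sum_mul]
    congr 1
    exact Finset.sum_congr rfl fun r _ => by ring
  have hC : (∑ r, (∑ m, ∑ μ, D.cC r k μ m z * D.torRT m μ β i z) * D.xLow α r z)
      = ∑ m, ∑ μ, ∑ r, D.cC r k μ m z * D.torRT m μ β i z * D.xLow α r z := by
    simp only [Finset.sum_mul]
    rw [Finset.sum_comm]
    exact Finset.sum_congr rfl fun m _ => Finset.sum_comm
  have hG : (∑ m, D.cG m i β z * D.defl α m k z)
      = (∑ m, D.cG m i β z * D.deltaX k (D.xLow α m) z)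
        - ∑ r, (∑ l, D.cL r l k z * D.cG l i β z) * D.xLow α r z := by
    simp only [defl, covX, mul_sub, Finset.sum_sub_distrib, Finset.mul_sum, Finset.sum_mul]
    congr 1
    rw [Finset.sum_comm]
    exact Finset.sum_congr rfl fun r _ => Finset.sum_congr rfl fun l _ => by ring
  have hT : (∑ r, (∑ l, D.cL r l k z * D.torT l β i z) * D.xLow α r z)
      = - ∑ r, (∑ l, D.cL r l k z * D.cG l i β z) * D.xLow α r z := by
    simp only [torT, mul_neg, Finset.sum_neg_distrib, neg_mul]
  rw [maxwellTerm, hbar, hD.deltaX_Dbar hz, hdefl, hv, maxwellSymm]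
  simp only [torTCovX, htor, add_mul, sub_mul, neg_mul, Finset.sum_add_distrib,
    Finset.sum_sub_distrib, Finset.sum_neg_distrib, hC, hG, hT]
  rw [← hcomm]
  ring

theorem maxwell_first (hD : D.IsKroneckerOn V W) (hz : z ∈ jetRegion V W) (α β : Fin p)
    (i k : Fin n) :
    D.covT₂ D.F α i k β z = 1 / 2 * (D.maxwellTerm α β i k z - D.maxwellTerm α β k i z) := by
  rw [hD.maxwellTerm_eq hz, hD.maxwellTerm_eq hz, hD.maxwellSymm_comm hz α β k i, covT₂,
    deltaT_eq_along, hD.along_F hz]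
  have h1 : (∑ γ, D.H α γ β z.1 * D.F γ i k z)
      = 1 / 2 * ((∑ γ, D.H α γ β z.1 * D.deltaX k (D.xLow γ i) z)
        - ∑ γ, D.H α γ β z.1 * D.deltaX i (D.xLow γ k) z) := by
    rw [← Finset.sum_sub_distrib, Finset.mul_sum]
    exact Finset.sum_congr rfl fun γ _ => by rw [hD.F_eq hz]; ring
  have h2 : (∑ m, D.cG m i β z * D.F α m k z)
      = 1 / 2 * ((∑ m, D.cG m i β z * D.defl α m k z)
        - ∑ m, D.cG m i β z * D.defl α k m z) := by
    rw [← Finset.sum_sub_distrib, Finset.mul_sum]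
    exact Finset.sum_congr rfl fun γ _ => by rw [F]; ring
  have h3 : (∑ m, D.cG m k β z * D.F α i m z)
      = 1 / 2 * ((∑ m, D.cG m k β z * D.defl α i m z)
        - ∑ m, D.cG m k β z * D.defl α m i z) := by
    rw [← Finset.sum_sub_distrib, Finset.mul_sum]
    exact Finset.sum_congr rfl fun γ _ => by rw [F]; ring
  rw [h1, h2, h3]
  ring

/-! ### Cyclic sums of covariant derivatives -/

theorem F_antisymm (D : LocalData p n) (α : Fin p) (i j : Fin n) (z : Coord p n) :
    D.F α i j z = - D.F α j i z := by
  rw [F, F]; ring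

theorem cyclicSum_covX₂_F (hD : D.IsKroneckerOn V W) (hz : z ∈ jetRegion V W) (α : Fin p)
    (i j k : Fin n) :
    cyclicSum (fun i j k => D.covX₂ D.F α i j k z) i j k
      = cyclicSum (fun i j k => D.deltaX k (D.F α i j) z) i j k := by
  -- By antisymmetry of F and symmetry of L, the second-slot correction for (i, j, k) is minus the
  -- first-slot correction for (k, i, j), so the two cancel in the cyclic sum.
  have h : ∀ i j k, (∑ m, D.cL m j k z * D.F α i m z) = - ∑ m, D.cL m k j z * D.F α m i z := by
    intro i j k
    rw [← Finset.sum_neg_distrib]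
    exact Finset.sum_congr rfl fun m _ => by rw [hD.cL_symm hz m j k, F_antisymm D α i m]; ring
  simp only [cyclicSum, covX₂, h]
  ring

theorem cyclicSum_covV₂_F {γ : Fin p} (hC : ∀ i j k, D.cC i j γ k z = D.cC i k γ j z)
    (α : Fin p) (i j k : Fin n) :
    cyclicSum (fun i j k => D.covV₂ D.F α i j γ k z) i j k
      = cyclicSum (fun i j k => dv k γ (D.F α i j) z) i j k := by
  have h : ∀ i j k, (∑ m, D.cC m j γ k z * D.F α i m z) = - ∑ m, D.cC m k γ j z * D.F α m i z := by
    intro i j k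
    rw [← Finset.sum_neg_distrib]
    exact Finset.sum_congr rfl fun m _ => by rw [hC m j k, F_antisymm D α i m]; ring
  simp only [cyclicSum, covV₂, h]
  ring

theorem cC_symm (hD : D.IsKroneckerOn V W) (hz : z ∈ jetRegion V W) (γ : Fin p) (i j k : Fin n) :
    D.cC i j γ k z = D.cC i k γ j z := by
  simp only [cC, dv_eq_along]
  refine Finset.sum_congr rfl fun m _ => ?_
  rw [hD.along_g_symm hz j k, add_comm (along _ _ _)]

end LocalData.IsKroneckerOn

/-- Lowers an index raised by an inverse matrix. It allows 𝒢^i and N to be handled in lowered form,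
without computing a derivative of g^{ij}. -/
theorem sum_mul_sum_nonsing_inv {ι : Type*} [Fintype ι] [DecidableEq ι] {A : Matrix ι ι ℝ}
    (hA : IsUnit A.det) (s : ι → ℝ) (i : ι) : ∑ m, A i m * ∑ k, A⁻¹ m k * s k = s i := by
  have h : A.mulVec (A⁻¹.mulVec s) = s := by
    rw [Matrix.mulVec_mulVec, Matrix.mul_nonsing_inv _ hA, Matrix.one_mulVec]
  exact congrFun h i

namespace LocalData.IsKroneckerOn

section VerticalDerivatives

variable {p n : ℕ} {D : LocalData p n} {V : Set (EuclideanSpace ℝ (Fin p))}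
  {W : Set (EuclideanSpace ℝ (Fin n))} {z : Coord p n}

/-! ### Vertical derivatives of the fundamental tensor -/

theorem dv_dv_comm (hD : D.IsKroneckerOn V W) (hz : z ∈ jetRegion V W) {f : Coord p n → ℝ}
    (hf : ContDiffOn ℝ ∞ f (jetRegion V W)) (i j : Fin n) (α β : Fin p) :
    dv i α (dv j β f) z = dv j β (dv i α f) z :=
  along_const_comm hD.isOpen _ _ hf hz

theorem dv_dx_comm (hD : D.IsKroneckerOn V W) (hz : z ∈ jetRegion V W) {f : Coord p n → ℝ}
    (hf : ContDiffOn ℝ ∞ f (jetRegion V W)) (i j : Fin n) (α : Fin p) :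
    dv i α (dx j f) z = dx j (dv i α f) z :=
  along_const_comm hD.isOpen _ _ hf hz

theorem dv_dt_comm (hD : D.IsKroneckerOn V W) (hz : z ∈ jetRegion V W) {f : Coord p n → ℝ}
    (hf : ContDiffOn ℝ ∞ f (jetRegion V W)) (i : Fin n) (α β : Fin p) :
    dv i α (dt β f) z = dt β (dv i α f) z :=
  along_const_comm hD.isOpen _ _ hf hz

theorem dx_dx_comm (hD : D.IsKroneckerOn V W) (hz : z ∈ jetRegion V W) {f : Coord p n → ℝ}
    (hf : ContDiffOn ℝ ∞ f (jetRegion V W)) (i j : Fin n) :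
    dx i (dx j f) z = dx j (dx i f) z :=
  along_const_comm hD.isOpen _ _ hf hz

theorem G_symm (hD : D.IsKroneckerOn V W) (hz : z ∈ jetRegion V W) (α β : Fin p) (i j : Fin n) :
    D.G α β i j z = D.G β α j i z := by
  rw [G, G, hD.dv_dv_comm hz hD.L]

theorem dv_G (hD : D.IsKroneckerOn V W) (hz : z ∈ jetRegion V W) (α β γ : Fin p)
    (i j k : Fin n) :
    dv k γ (D.G α β i j) z = 1 / 2 * dv k γ (dv i α (dv j β D.L)) z :=
  along_const_mul (V := fun _ => vecFibre k γ) _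
    (hD.differentiableAt (hD.contDiffOn_dv (hD.contDiffOn_dv hD.L j β) i α) hz)

/-- Third vertical derivatives of L commute. Together with `dv_G_symm` this yields every permutation
of the pairs (i, α), (j, β), (k, γ). -/
theorem dv_G_swap (hD : D.IsKroneckerOn V W) (hz : z ∈ jetRegion V W) (α β γ : Fin p)
    (i j k : Fin n) :
    dv k γ (D.G α β i j) z = dv i α (D.G γ β k j) z := by
  rw [hD.dv_G hz, hD.dv_G hz, hD.dv_dv_comm hz (hD.contDiffOn_dv hD.L _ _)]

theorem dv_G_symm (hD : D.IsKroneckerOn V W) (hz : z ∈ jetRegion V W) (α β γ : Fin p)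
    (i j k : Fin n) :
    dv k γ (D.G α β i j) z = dv k γ (D.G β α j i) z :=
  along_congr (V := fun _ => vecFibre k γ) hD.isOpen (fun _ hw => hD.G_symm hw α β i j) hz

theorem hInv_mul_dv_g (hD : D.IsKroneckerOn V W) (hz : z ∈ jetRegion V W) (α β γ : Fin p)
    (i j k : Fin n) :
    D.hInv α β z.1 * dv k γ (fun w => D.g w i j) z = dv k γ (D.G α β i j) z := by
  have hd := hD.differentiableAt (comp_time (hD.contDiffOn_hInv α β)) hz
  have h0 := hD.along_comp_time hz (hD.contDiffOn_hInv α β) (fun _ => vecFibre k γ) rfl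
  rw [dv_eq_along, along_congr (f := D.G α β i j) hD.isOpen (fun w hw => hD.regular w hw α β i j) hz,
    along_mul hd (hD.differentiableAt (hD.g i j) hz), h0]
  ring

theorem dv_xLow (hD : D.IsKroneckerOn V W) (hz : z ∈ jetRegion V W) (α γ : Fin p)
    (i k : Fin n) :
    dv k γ (D.xLow α i) z
      = D.G α γ i k z + ∑ l, ∑ η, dv k γ (D.G α η i l) z * z.2.2 l η := by
  have hG : ∀ l η, DifferentiableAt ℝ (D.G α η i l) z := fun l η =>
    hD.differentiableAt (hD.contDiffOn_G _ _ _ _) hz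
  have hx : ∀ l η, DifferentiableAt ℝ (fun w : Coord p n => w.2.2 l η) z := fun l η =>
    hD.differentiableAt (contDiffOn_fibre l η _) hz
  rw [dv_eq_along]
  change along _ (fun w => ∑ l, ∑ η, D.G α η i l w * w.2.2 l η) z = _
  rw [along_sum fun l _ => DifferentiableAt.fun_sum fun η _ => (hG l η).fun_mul (hx l η)]
  simp only [along_sum fun η _ => (hG _ η).fun_mul (hx _ η), along_mul (hG _ _) (hx _ _),
    along_vecFibre_fibre, Finset.sum_add_distrib]
  simp [ite_and]

/-- The field ∂/∂x^k_γ is constant, so the bracket differentiates only the coefficients N. -/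
theorem dv_deltaX_sub (hD : D.IsKroneckerOn V W) {f : Coord p n → ℝ}
    (hf : ContDiffOn ℝ ∞ f (jetRegion V W)) (k j : Fin n) (γ : Fin p)
    (hz : z ∈ jetRegion V W) :
    dv k γ (D.deltaX j f) z - D.deltaX j (dv k γ f) z
      = - ∑ m, ∑ μ, dv k γ (D.N m μ j) z * dv m μ f z := by
  simp only [dv_eq_along, deltaX_eq_along]
  rw [along_along_sub hD.isOpen contDiffOn_const (hD.contDiffOn_vecX j) hf hz]
  unfold vecX
  rw [fderiv_horizontal fun i α => hD.differentiableAt (hD.contDiffOn_N i α j) hz]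
  simp only [fderiv_fun_const, Pi.zero_apply, zero_apply, sub_zero, map_neg,
    map_sum, map_smul, smul_eq_mul]
  rfl

end VerticalDerivatives

section OneTime

variable {n : ℕ} {D : LocalData 1 n} {V : Set (EuclideanSpace ℝ (Fin 1))}
  {W : Set (EuclideanSpace ℝ (Fin n))} {z : Coord 1 n}

/-! ### One temporal dimension -/

theorem hInv_mul_h (hD : D.IsKroneckerOn V W) (hz : z ∈ jetRegion V W) :
    D.hInv 0 0 z.1 * D.h z.1 0 0 = 1 := by
  have := congrFun (congrFun (Matrix.nonsing_inv_mul _ (hD.h_unit z.1 hz.1)) 0) 0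
  simpa only [Matrix.mul_apply, Fin.sum_univ_one, Matrix.one_apply_eq, hInv] using this

theorem dv_g_swap (hD : D.IsKroneckerOn V W) (hz : z ∈ jetRegion V W) (i j k : Fin n) :
    dv k 0 (fun w => D.g w i j) z = dv i 0 (fun w => D.g w k j) z := by
  refine mul_left_cancel₀ (left_ne_zero_of_mul_eq_one (hD.hInv_mul_h hz)) ?_
  rw [hD.hInv_mul_dv_g hz, hD.hInv_mul_dv_g hz, hD.dv_G_swap hz]

theorem dv_g_symm (hD : D.IsKroneckerOn V W) (hz : z ∈ jetRegion V W) (i j k : Fin n) :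
    dv k 0 (fun w => D.g w i j) z = dv k 0 (fun w => D.g w j i) z :=
  hD.along_g_symm hz i j fun _ => vecFibre k 0

theorem Clow_eq (hD : D.IsKroneckerOn V W) (hz : z ∈ jetRegion V W) (i l m : Fin n) :
    D.Clow 0 0 0 i l m z = 1 / 2 * dv i 0 (D.G 0 0 l m) z := by
  have h1 : ∀ q, D.cC q i 0 m z
      = ∑ s, (D.g z)⁻¹ q s * (1 / 2 * dv i 0 (fun w => D.g w s m) z) := by
    intro q
    -- For p = 1 the derivative ∂g_{ij}/∂y^k is totally symmetric, so the first and third terms of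
    -- the Christoffel-type formula cancel.
    refine Finset.sum_congr rfl fun s _ => ?_
    rw [hD.dv_g_swap hz s i m, hD.dv_g_symm hz m i s, gInv]
    ring
  have h2 := sum_mul_sum_nonsing_inv (hD.g_unit z hz)
    (fun s => 1 / 2 * dv i 0 (fun w => D.g w s m) z) l
  simp only [Clow, h1, hD.regular z hz, mul_assoc]
  rw [← Finset.mul_sum, h2, ← hD.hInv_mul_dv_g hz]
  ring

theorem Clow_eq_dv (hD : D.IsKroneckerOn V W) (hz : z ∈ jetRegion V W) (i l m : Fin n) :
    D.Clow 0 0 0 i l m z = 1 / 4 * dv i 0 (dv l 0 (dv m 0 D.L)) z := by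
  rw [hD.Clow_eq hz, hD.dv_G hz]
  ring

theorem sum_g_mul_spray (hD : D.IsKroneckerOn V W) (hz : z ∈ jetRegion V W) (i : Fin n) :
    ∑ m, D.g z i m * D.spray 0 m z = sprayLow D 0 i z := by
  simp only [spray_eq]
  exact sum_mul_sum_nonsing_inv (hD.g_unit z hz) _ i

theorem sum_g_mul_dv_spray (hD : D.IsKroneckerOn V W) (hz : z ∈ jetRegion V W) (i j : Fin n) :
    ∑ m, D.g z i m * dv j 0 (D.spray 0 m) z
      = dv j 0 (sprayLow D 0 i) z - ∑ m, dv j 0 (fun w => D.g w i m) z * D.spray 0 m z := by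
  have hg : ∀ m, DifferentiableAt ℝ (fun w => D.g w i m) z := fun m =>
    hD.differentiableAt (hD.g i m) hz
  have hs : ∀ m, DifferentiableAt ℝ (D.spray 0 m) z := fun m =>
    hD.differentiableAt (hD.contDiffOn_spray _ _) hz
  simp only [dv_eq_along]
  rw [← along_congr (f := fun w => ∑ m, D.g w i m * D.spray 0 m w) hD.isOpen
    (fun w hw => hD.sum_g_mul_spray hw i) hz, along_sum fun m _ => (hg m).fun_mul (hs m)]
  simp only [along_mul (hg _) (hs _), Finset.sum_add_distrib, add_sub_cancel_right]

/-- Isolates the only part not symmetric in i, j, namely ¼(∂p_i/∂x^j − ∂p_j/∂x^i) with p_i =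
∂L/∂y^i: its first half comes from differentiating the factor y^j, its second from −∂L/∂x^i. -/
theorem dv_sprayLow (hD : D.IsKroneckerOn V W) (hz : z ∈ jetRegion V W) (i j : Fin n) :
    dv j 0 (sprayLow D 0 i) z = 1 / 4 * (dx j (dv i 0 D.L) z
      + (∑ l, dx l (dv j 0 (dv i 0 D.L)) z * z.2.2 l 0) - dx i (dv j 0 D.L) z
      + dt 0 (dv j 0 (dv i 0 D.L)) z + dv j 0 (dv i 0 D.L) z * D.H 0 0 0 z.1
      + 2 * D.hInv 0 0 z.1 * D.H 0 0 0 z.1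
        * (D.g z i j + ∑ l, dv j 0 (fun w => D.g w i l) z * z.2.2 l 0)) := by
  have hv := hD.contDiffOn_dv hD.L i 0
  have hvd := hD.differentiableAt hv hz
  have hx : ∀ l, DifferentiableAt ℝ (fun w : Coord 1 n => w.2.2 l 0) z := fun l =>
    hD.differentiableAt (contDiffOn_fibre l 0 _) hz
  have hdx : ∀ l, DifferentiableAt ℝ (dx l (dv i 0 D.L)) z := fun l =>
    hD.differentiableAt (hD.contDiffOn_dx hv l) hz
  have hdxi : DifferentiableAt ℝ (dx i D.L) z :=
    hD.differentiableAt (hD.contDiffOn_dx hD.L i) hz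
  have hdt : DifferentiableAt ℝ (dt 0 (dv i 0 D.L)) z :=
    hD.differentiableAt (hD.contDiffOn_dt hv 0) hz
  have hg : ∀ l, DifferentiableAt ℝ (fun w => D.g w i l) z := fun l =>
    hD.differentiableAt (hD.g i l) hz
  have hH : DifferentiableAt ℝ (fun w : Coord 1 n => D.H 0 0 0 w.1) z :=
    hD.differentiableAt (comp_time (hD.contDiffOn_H _ _ _)) hz
  have hcC : ContDiffOn ℝ ∞ (fun u => 2 * D.hInv 0 0 u * D.H 0 0 0 u) V :=
    (contDiffOn_const.mul (hD.contDiffOn_hInv 0 0)).mul (hD.contDiffOn_H 0 0 0)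
  have hc : DifferentiableAt ℝ (fun w : Coord 1 n => 2 * D.hInv 0 0 w.1 * D.H 0 0 0 w.1) z :=
    hD.differentiableAt (comp_time hcC) hz
  have hH0 := hD.along_comp_time hz (hD.contDiffOn_H 0 0 0) (fun _ => vecFibre j 0) rfl
  have hc0 := hD.along_comp_time hz hcC (fun _ => vecFibre j 0) rfl
  have s1 : DifferentiableAt ℝ (fun w => ∑ l, dx l (dv i 0 D.L) w * w.2.2 l 0) z :=
    DifferentiableAt.fun_sum fun l _ => (hdx l).fun_mul (hx l)
  have s2 : DifferentiableAt ℝ (fun w => ∑ l, D.g w i l * w.2.2 l 0) z :=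
    DifferentiableAt.fun_sum fun l _ => (hg l).fun_mul (hx l)
  have e1 : ∀ l, dv j 0 (dx l (dv i 0 D.L)) z = dx l (dv j 0 (dv i 0 D.L)) z := fun l =>
    hD.dv_dx_comm hz hv j l 0
  have e2 := hD.dv_dx_comm hz hD.L j i 0
  have e3 := hD.dv_dt_comm hz hv j 0 0
  rw [dv_eq_along] at e1 e2 e3 ⊢
  change along _ (fun w => 1 / 4 * ((∑ l, dx l (dv i 0 D.L) w * w.2.2 l 0) - dx i D.L w
    + dt 0 (dv i 0 D.L) w + dv i 0 D.L w * D.H 0 0 0 w.1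
    + 2 * D.hInv 0 0 w.1 * D.H 0 0 0 w.1 * ∑ l, D.g w i l * w.2.2 l 0)) z = _
  rw [along_const_mul _ ((((s1.fun_sub hdxi).fun_add hdt).fun_add (hvd.fun_mul hH)).fun_add
      (hc.fun_mul s2)),
    along_add (((s1.fun_sub hdxi).fun_add hdt).fun_add (hvd.fun_mul hH)) (hc.fun_mul s2),
    along_add ((s1.fun_sub hdxi).fun_add hdt) (hvd.fun_mul hH),
    along_add (s1.fun_sub hdxi) hdt, along_sub s1 hdxi, along_mul hvd hH, along_mul hc s2,
    along_sum fun l _ => (hdx l).fun_mul (hx l), along_sum fun l _ => (hg l).fun_mul (hx l),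
    hH0, hc0]
  simp only [along_mul (hdx _) (hx _), along_mul (hg _) (hx _), along_vecFibre_fibre,
    Finset.sum_add_distrib, and_true, mul_ite, mul_one, mul_zero, Finset.sum_ite_eq',
    Finset.mem_univ, if_true, zero_mul, zero_add, add_zero]
  rw [e2, e3]
  simp only [← e1]

theorem dv_dv_L_symm_along (hD : D.IsKroneckerOn V W) (hz : z ∈ jetRegion V W) (i j : Fin n)
    (Y : Coord 1 n → Coord 1 n) :
    along Y (dv j 0 (dv i 0 D.L)) z = along Y (dv i 0 (dv j 0 D.L)) z :=
  along_congr hD.isOpen (fun _ hw => hD.dv_dv_comm hw hD.L j i 0 0) hz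

/-- The canonical spatial distribution is Lagrangian for the Cartan two-form of `L`. -/
theorem deltaX_dv_L_symm (hD : D.IsKroneckerOn V W) (hz : z ∈ jetRegion V W) (i j : Fin n) :
    D.deltaX j (dv i 0 D.L) z = D.deltaX i (dv j 0 D.L) z := by
  -- Regularity gives ∂²L/∂y^m∂y^i = 2h^{11}g_{im}, and the factor h_{11} of N cancels h^{11}.
  have hN : ∀ i j, D.deltaX j (dv i 0 D.L) z
      = dx j (dv i 0 D.L) z - 2 * ∑ m, D.g z i m * dv j 0 (D.spray 0 m) z := by
    intro i j
    simp only [deltaX, Fin.sum_univ_one, N, if_true, Finset.mul_sum]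
    congr 1
    refine Finset.sum_congr rfl fun m _ => ?_
    have hr := hD.regular z hz 0 0 m i
    rw [G] at hr
    have hm : dv m 0 (dv i 0 D.L) z = 2 * (D.hInv 0 0 z.1 * D.g z i m) := by
      rw [hD.g_symm z hz i m]; linarith
    rw [hm]
    linear_combination (2 * D.g z i m * dv j 0 (D.spray 0 m) z) * hD.hInv_mul_h hz
  have h1 : ∀ l, dx l (dv j 0 (dv i 0 D.L)) z = dx l (dv i 0 (dv j 0 D.L)) z := fun l =>
    hD.dv_dv_L_symm_along hz i j fun _ => vecSpace l
  have h2 : dt 0 (dv j 0 (dv i 0 D.L)) z = dt 0 (dv i 0 (dv j 0 D.L)) z :=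
    hD.dv_dv_L_symm_along hz i j fun _ => vecTime 0
  -- The product rule leaves (∂g_{im}/∂y^j)𝒢^m, symmetric in i, j. The non-symmetric part of the
  -- lowered spray turns ∂p_i/∂x^j into ½(∂p_i/∂x^j + ∂p_j/∂x^i).
  rw [hN, hN, hD.sum_g_mul_dv_spray hz, hD.sum_g_mul_dv_spray hz, hD.dv_sprayLow hz,
    hD.dv_sprayLow hz]
  simp only [h1, h2, hD.dv_dv_comm hz hD.L j i, hD.g_symm z hz i j, hD.dv_g_swap hz i _ j]
  ring

/-- Since ∂p_i/∂y^m = 2G_{im}, the sum is half the cyclic sum of [δ_j, δ_k]p_i, which telescopes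
because δ_j p_i is symmetric in i, j. -/
theorem cyclicSum_G_torRX (hD : D.IsKroneckerOn V W) (hz : z ∈ jetRegion V W) (i j k : Fin n) :
    cyclicSum (fun i j k => ∑ m, D.G 0 0 i m z * D.torRX m 0 j k z) i j k = 0 := by
  have h : ∀ i j k, D.deltaX j (D.deltaX k (dv i 0 D.L)) z - D.deltaX k (D.deltaX j (dv i 0 D.L)) z
      = 2 * ∑ m, D.G 0 0 i m z * D.torRX m 0 j k z := by
    intro i j k
    rw [hD.deltaX_deltaX_sub (hD.contDiffOn_dv hD.L i 0) j k hz, Finset.mul_sum]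
    refine Finset.sum_congr rfl fun m _ => ?_
    rw [Fin.sum_univ_one, hD.G_symm hz, G]
    ring
  have hs : ∀ i j k, D.deltaX k (D.deltaX j (dv i 0 D.L)) z
      = D.deltaX k (D.deltaX i (dv j 0 D.L)) z := by
    intro i j k
    rw [D.deltaX_eq_along k]
    exact along_congr hD.isOpen (fun w hw => hD.deltaX_dv_L_symm hw i j) hz
  have h1 := h i j k
  have h2 := h j k i
  have h3 := h k i j
  simp only [cyclicSum]
  linarith [hs i j k, hs j k i, hs k i j]

theorem maxwell_second_one (hD : D.IsKroneckerOn V W) (hz : z ∈ jetRegion V W) (i j k : Fin n) :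
    cyclicSum (fun i j k => D.covX₂ D.F 0 i j k z) i j k
      = - cyclicSum (fun i j k =>
          ∑ l, ∑ m, D.Clow 0 0 0 i l m z * D.torRX m 0 j k z * z.2.2 l 0) i j k := by
  rw [hD.cyclicSum_covX₂_F hz]
  have hF : ∀ i j k, D.deltaX k (D.F 0 i j) z
      = 1 / 2 * (D.deltaX k (D.deltaX j (D.xLow 0 i)) z
        - D.deltaX k (D.deltaX i (D.xLow 0 j)) z) := by
    intro i j k
    rw [D.deltaX_eq_along k]
    exact hD.along_F hz 0 i j _
  have hc : ∀ i j k, D.deltaX j (D.deltaX k (D.xLow 0 i)) z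
        - D.deltaX k (D.deltaX j (D.xLow 0 i)) z
      = (∑ m, D.G 0 0 i m z * D.torRX m 0 j k z)
        + 2 * ∑ l, ∑ m, D.Clow 0 0 0 i l m z * D.torRX m 0 j k z * z.2.2 l 0 := by
    intro i j k
    rw [hD.deltaX_deltaX_sub (hD.contDiffOn_xLow 0 i) j k hz, Finset.sum_comm (f := fun l m =>
      D.Clow 0 0 0 i l m z * D.torRX m 0 j k z * z.2.2 l 0), Finset.mul_sum, ← Finset.sum_add_distrib]
    refine Finset.sum_congr rfl fun m _ => ?_
    rw [Fin.sum_univ_one, hD.dv_xLow hz]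
    simp only [Fin.sum_univ_one]
    rw [add_mul, Finset.sum_mul, Finset.mul_sum]
    congr 1
    refine Finset.sum_congr rfl fun l _ => ?_
    rw [hD.Clow_eq hz, hD.dv_G_swap hz 0 0 0 i l m, hD.dv_G_symm hz 0 0 0 m l i]
    ring
  have h1 := hc i j k
  have h2 := hc j k i
  have h3 := hc k i j
  have h0 := hD.cyclicSum_G_torRX hz i j k
  -- The terms ½(δ_kδ_j x_i − δ_kδ_i x_j) regroup cyclically into −½[δ_j, δ_k]x_i.
  simp only [cyclicSum, hF] at h0 ⊢
  linarith

theorem dv_xLow_symm (hD : D.IsKroneckerOn V W) (hz : z ∈ jetRegion V W) (i k : Fin n) :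
    dv k 0 (D.xLow 0 i) z = dv i 0 (D.xLow 0 k) z := by
  rw [hD.dv_xLow hz, hD.dv_xLow hz, hD.G_symm hz]
  simp only [Fin.sum_univ_one, hD.dv_G_swap hz 0 0 0 i _ k]

theorem dv_N_symm (hD : D.IsKroneckerOn V W) (hz : z ∈ jetRegion V W) (m j k : Fin n) :
    dv k 0 (D.N m 0 j) z = dv j 0 (D.N m 0 k) z := by
  have h : ∀ j k, dv k 0 (D.N m 0 j) z = D.h z.1 0 0 * dv k 0 (dv j 0 (D.spray 0 m)) z := by
    intro j k
    have hN : D.N m 0 j = fun w => D.h w.1 0 0 * dv j 0 (D.spray 0 m) w := by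
      funext w; simp [N]
    have h0 := hD.along_comp_time hz (hD.h 0 0) (fun _ => vecFibre k 0) rfl
    rw [hN, dv_eq_along k, along_mul (hD.differentiableAt (comp_time (hD.h 0 0)) hz)
      (hD.differentiableAt (hD.contDiffOn_dv (hD.contDiffOn_spray 0 m) j 0) hz), h0]
    ring
  rw [h, h, hD.dv_dv_comm hz (hD.contDiffOn_spray 0 m)]

theorem maxwell_third_one (hD : D.IsKroneckerOn V W) (hz : z ∈ jetRegion V W) (i j k : Fin n) :
    cyclicSum (fun i j k => D.covV₂ D.F 0 i j 0 k z) i j k = 0 := by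
  rw [cyclicSum_covV₂_F fun i j k => hD.cC_symm hz 0 i j k]
  have hF : ∀ i j k, dv k 0 (D.F 0 i j) z
      = 1 / 2 * (dv k 0 (D.deltaX j (D.xLow 0 i)) z - dv k 0 (D.deltaX i (D.xLow 0 j)) z) :=
    fun i j k => hD.along_F hz 0 i j fun _ => vecFibre k 0
  have hB : ∀ i j k, D.deltaX j (dv k 0 (D.xLow 0 i)) z
      = D.deltaX j (dv i 0 (D.xLow 0 k)) z := by
    intro i j k
    rw [D.deltaX_eq_along j]
    exact along_congr hD.isOpen (fun w hw => hD.dv_xLow_symm hw i k) hz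
  have hc : ∀ i j k, dv k 0 (D.deltaX j (D.xLow 0 i)) z - D.deltaX j (dv k 0 (D.xLow 0 i)) z
      = - ∑ m, dv k 0 (D.N m 0 j) z * dv m 0 (D.xLow 0 i) z := by
    intro i j k
    simpa only [Fin.sum_univ_one] using hD.dv_deltaX_sub (hD.contDiffOn_xLow 0 i) k j 0 hz
  have hn : ∀ i j k, (∑ m, dv k 0 (D.N m 0 j) z * dv m 0 (D.xLow 0 i) z)
      = ∑ m, dv j 0 (D.N m 0 k) z * dv m 0 (D.xLow 0 i) z := by
    intro i j k
    exact Finset.sum_congr rfl fun m _ => by rw [hD.dv_N_symm hz]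
  -- After moving δ_j outside the vertical derivative, the second-order terms cancel by `hB` and the
  -- bracket terms by `hn`.
  simp only [cyclicSum, hF]
  linarith [hc i j k, hc j k i, hc k i j, hc j i k, hc k j i, hc i k j, hB i j k, hB j k i,
    hB k i j, hn i j k, hn j k i, hn k i j]

end OneTime
end LocalData.IsKroneckerOn

namespace LocalData.IsKroneckerOn

section SeveralTimes

variable {p n : ℕ} {D : LocalData p n} {V : Set (EuclideanSpace ℝ (Fin p))}
  {W : Set (EuclideanSpace ℝ (Fin n))} {z : Coord p n}

/-! ### Several temporal dimensions -/

/-- Exchanging (j, β) with (k, γ) in the third vertical derivative of L gives `hswap`. Contracting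
it with h_{βα} over α and β yields the trace p on the left and δ_{βγ} on the right. -/
theorem natCast_mul_dv_g (hD : D.IsKroneckerOn V W) (hz : z ∈ jetRegion V W) (γ : Fin p)
    (i j k : Fin n) :
    (p : ℝ) * dv k γ (fun w => D.g w i j) z = dv j γ (fun w => D.g w i k) z := by
  have hmul := Matrix.mul_nonsing_inv _ (hD.h_unit z.1 hz.1)
  have hone : ∀ β γ, ∑ α, D.h z.1 β α * D.hInv α γ z.1 = (1 : Matrix (Fin p) (Fin p) ℝ) β γ :=
    fun β γ => by rw [← hmul, Matrix.mul_apply]; rfl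
  have hswap : ∀ α β, D.hInv α β z.1 * dv k γ (fun w => D.g w i j) z
      = D.hInv α γ z.1 * dv j β (fun w => D.g w i k) z := by
    intro α β
    rw [hD.hInv_mul_dv_g hz, hD.hInv_mul_dv_g hz, hD.dv_G_symm hz, hD.dv_G_swap hz,
      hD.dv_G_symm hz]
  calc (p : ℝ) * dv k γ (fun w => D.g w i j) z
      = ∑ β, (∑ α, D.h z.1 β α * D.hInv α β z.1) * dv k γ (fun w => D.g w i j) z := by
        simp [hone]
    _ = ∑ β, (∑ α, D.h z.1 β α * D.hInv α γ z.1) * dv j β (fun w => D.g w i k) z := by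
        refine Finset.sum_congr rfl fun β _ => ?_
        rw [Finset.sum_mul, Finset.sum_mul]
        refine Finset.sum_congr rfl fun α _ => ?_
        rw [mul_assoc, hswap, mul_assoc]
    _ = dv j γ (fun w => D.g w i k) z := by
        simp [hone, Matrix.one_apply]

/-- Applying the previous relation twice multiplies the derivative by p², and p² ≠ 1. -/
theorem dv_g_eq_zero (hD : D.IsKroneckerOn V W) (hp : 2 ≤ p) (hz : z ∈ jetRegion V W) (γ : Fin p)
    (i j k : Fin n) : dv k γ (fun w => D.g w i j) z = 0 := by
  have h1 := hD.natCast_mul_dv_g hz γ i j k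
  have h2 := hD.natCast_mul_dv_g hz γ i k j
  have hp' : (2 : ℝ) ≤ p := by exact_mod_cast hp
  have h3 : ((p : ℝ) * p - 1) * dv k γ (fun w => D.g w i j) z = 0 := by
    rw [sub_mul, mul_assoc, h1, h2]; ring
  exact (mul_eq_zero.mp h3).resolve_left (by nlinarith)

theorem deltaX_g (hD : D.IsKroneckerOn V W) (hp : 2 ≤ p) (hz : z ∈ jetRegion V W)
    (i j k : Fin n) : D.deltaX k (fun w => D.g w i j) z = dx k (fun w => D.g w i j) z := by
  simp [deltaX, hD.dv_g_eq_zero hp hz]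

/-- `g_{ik} N^{(k)}_{(γ)j}` for at least two temporal dimensions. -/
def connLow (D : LocalData p n) (γ : Fin p) (j i : Fin n) (z : Coord p n) : ℝ :=
  (∑ l, 1 / 2 * (dx l (fun w => D.g w i j) z + dx j (fun w => D.g w i l) z
      - dx i (fun w => D.g w j l) z) * z.2.2 l γ)
    + 1 / 2 * dt γ (fun w => D.g w j i) z + 1 / 4 * ∑ β, D.h z.1 γ β * D.curlU β i j z

theorem N_eq (D : LocalData p n) (hp : 2 ≤ p) (i : Fin n) (γ : Fin p) (j : Fin n)
    (z : Coord p n) : D.N i γ j z = ∑ k, (D.g z)⁻¹ i k * connLow D γ j k z := by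
  have hp1 : p ≠ 1 := by omega
  have hΓ : (∑ l, D.Γ i j l z * z.2.2 l γ)
      = ∑ k, ∑ l, (D.g z)⁻¹ i k * (1 / 2 * (dx l (fun w => D.g w k j) z
        + dx j (fun w => D.g w k l) z - dx k (fun w => D.g w j l) z) * z.2.2 l γ) := by
    rw [Finset.sum_comm]
    refine Finset.sum_congr rfl fun l _ => ?_
    rw [Γ, Finset.sum_mul]
    refine Finset.sum_congr rfl fun k _ => ?_
    rw [gInv]; ring
  simp only [N, if_neg hp1, hΓ, ← Finset.sum_add_distrib]
  refine Finset.sum_congr rfl fun k _ => ?_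
  simp only [connLow, mul_add, Finset.mul_sum, gInv]
  congr 1
  · congr 1; ring
  · exact Finset.sum_congr rfl fun β _ => by ring

theorem sum_g_mul_N (hD : D.IsKroneckerOn V W) (hp : 2 ≤ p) (hz : z ∈ jetRegion V W) (γ : Fin p)
    (i j : Fin n) : ∑ k, D.g z i k * D.N k γ j z = connLow D γ j i z := by
  simp only [N_eq D hp]
  exact sum_mul_sum_nonsing_inv (hD.g_unit z hz) _ i

theorem curlU_antisymm (D : LocalData p n) (α : Fin p) (i j : Fin n) (z : Coord p n) :
    D.curlU α i j z = - D.curlU α j i z := by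
  rw [curlU, curlU]; ring

/-- The terms ∂g_{ij}/∂x^l and ∂g_{ij}/∂t^γ are symmetric and drop out, while the curl is
antisymmetric and doubles. -/
theorem connLow_sub (hD : D.IsKroneckerOn V W) (hz : z ∈ jetRegion V W) (γ : Fin p)
    (i j : Fin n) :
    connLow D γ j i z - connLow D γ i j z
      = (∑ l, dx j (fun w => D.g w i l) z * z.2.2 l γ)
        - (∑ l, dx i (fun w => D.g w j l) z * z.2.2 l γ)
        + 1 / 2 * ∑ β, D.h z.1 γ β * D.curlU β i j z := by
  have hdx : ∀ l, dx l (fun w => D.g w j i) z = dx l (fun w => D.g w i j) z := fun l =>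
    hD.along_g_symm hz j i fun _ => vecSpace l
  have hdt : dt γ (fun w => D.g w j i) z = dt γ (fun w => D.g w i j) z :=
    hD.along_g_symm hz j i fun _ => vecTime γ
  have hsum : (∑ l, 1 / 2 * (dx l (fun w => D.g w i j) z + dx j (fun w => D.g w i l) z
        - dx i (fun w => D.g w j l) z) * z.2.2 l γ)
      - (∑ l, 1 / 2 * (dx l (fun w => D.g w i j) z + dx i (fun w => D.g w j l) z
        - dx j (fun w => D.g w i l) z) * z.2.2 l γ)
      = (∑ l, dx j (fun w => D.g w i l) z * z.2.2 l γ)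
        - ∑ l, dx i (fun w => D.g w j l) z * z.2.2 l γ := by
    simp only [← Finset.sum_sub_distrib]
    exact Finset.sum_congr rfl fun l _ => by ring
  simp only [connLow, hdx, hdt, curlU_antisymm D _ j i, mul_neg, Finset.sum_neg_distrib]
  linear_combination hsum

/-- Here x_i = h^{αγ} g_{il} x^l_γ, where δ_j does not see h^{αγ}, acts on g as ∂/∂x^j, and sends
x^l_γ to −N^l_{γj}. -/
theorem deltaX_xLow (hD : D.IsKroneckerOn V W) (hp : 2 ≤ p) (hz : z ∈ jetRegion V W)
    (α : Fin p) (i j : Fin n) :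
    D.deltaX j (D.xLow α i) z = ∑ γ, D.hInv α γ z.1 *
      ((∑ l, dx j (fun w => D.g w i l) z * z.2.2 l γ) - connLow D γ j i z) := by
  have hh : ∀ γ, DifferentiableAt ℝ (fun w : Coord p n => D.hInv α γ w.1) z := fun γ =>
    hD.differentiableAt (comp_time (hD.contDiffOn_hInv α γ)) hz
  have hg : ∀ l, DifferentiableAt ℝ (fun w => D.g w i l) z := fun l =>
    hD.differentiableAt (hD.g i l) hz
  have hx : ∀ l γ, DifferentiableAt ℝ (fun w : Coord p n => w.2.2 l γ) z := fun l γ =>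
    hD.differentiableAt (contDiffOn_fibre l γ _) hz
  have hX : Set.EqOn (D.xLow α i)
      (fun w => ∑ l, ∑ γ, D.hInv α γ w.1 * D.g w i l * w.2.2 l γ) (jetRegion V W) := by
    intro w hw
    simp only [xLow, hD.regular w hw]
  have hδg : ∀ l, along (D.vecX j) (fun w => D.g w i l) z = dx j (fun w => D.g w i l) z := by
    intro l
    rw [← D.deltaX_eq_along, hD.deltaX_g hp hz]
  rw [deltaX_eq_along, along_congr hD.isOpen hX hz,
    along_sum fun l _ => DifferentiableAt.fun_sum fun γ _ =>
      ((hh γ).fun_mul (hg l)).fun_mul (hx l γ)]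
  simp only [along_sum fun γ _ => ((hh γ).fun_mul (hg _)).fun_mul (hx _ γ),
    along_mul ((hh _).fun_mul (hg _)) (hx _ _), along_mul (hh _) (hg _), along_vecX_fibre, hδg,
    hD.along_comp_time hz (hD.contDiffOn_hInv _ _) _ (vecX_fst D j z), zero_mul, add_zero]
  rw [Finset.sum_comm]
  refine Finset.sum_congr rfl fun γ _ => ?_
  rw [← hD.sum_g_mul_N hp hz, ← Finset.sum_sub_distrib, Finset.mul_sum]
  exact Finset.sum_congr rfl fun l _ => by ring

/-- The velocity terms of the alternated connection match those from differentiating g, so only U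
survives. The constant is ½ from F times ½ from the doubled curl. -/
theorem F_eq_curlU (hD : D.IsKroneckerOn V W) (hp : 2 ≤ p) (hz : z ∈ jetRegion V W)
    (α : Fin p) (i j : Fin n) : D.F α i j z = - (1 / 4) * D.curlU α i j z := by
  -- Applied to h⁻¹, whose inverse is h, this writes curl U as h⁻¹h curl U, the shape in which it
  -- occurs in F.
  have hinv := sum_mul_sum_nonsing_inv (Matrix.isUnit_nonsing_inv_det _ (hD.h_unit z.1 hz.1))
    (fun β => D.curlU β i j z) α
  rw [Matrix.nonsing_inv_nonsing_inv _ (hD.h_unit z.1 hz.1)] at hinv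
  rw [hD.F_eq hz, hD.deltaX_xLow hp hz, hD.deltaX_xLow hp hz, ← hinv, ← Finset.sum_sub_distrib,
    Finset.mul_sum, Finset.mul_sum]
  refine Finset.sum_congr rfl fun γ _ => ?_
  rw [hInv]
  linear_combination - (1 / 2) * (D.h z.1)⁻¹ α γ * hD.connLow_sub hz γ i j

/-- U factors through (t, x, v) ↦ (t, x, 0), whose differential kills vertical vectors. -/
theorem dv_U (hD : D.IsKroneckerOn V W) (hz : z ∈ jetRegion V W) (α γ : Fin p) (i k : Fin n) :
    dv k γ (D.U α i) z = 0 := by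
  have hd := hD.differentiableAt (hD.contDiffOn_dv hD.L i α) (z := (z.1, z.2.1, 0)) hz
  have h0 : HasFDerivAt (fun w : Coord p n => ((w.1, w.2.1, 0) : Coord p n))
      ((ContinuousLinearMap.fst ℝ _ _).prod
        (((ContinuousLinearMap.fst ℝ _ _).comp (ContinuousLinearMap.snd ℝ _ _)).prod 0)) z :=
    hasFDerivAt_fst.prodMk ((hasFDerivAt_fst.comp z hasFDerivAt_snd).prodMk
      (hasFDerivAt_const _ _))
  have h1 := (hd.hasFDerivAt.comp z h0).fderiv
  change fderiv ℝ (dv i α D.L ∘ fun w => (w.1, w.2.1, 0)) z (vecFibre k γ) = 0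
  rw [h1]
  simp only [vecFibre, ContinuousLinearMap.comp_apply, ContinuousLinearMap.prod_apply,
    ContinuousLinearMap.coe_fst', ContinuousLinearMap.coe_snd', zero_apply]
  exact map_zero _

theorem dv_curlU (hD : D.IsKroneckerOn V W) (hz : z ∈ jetRegion V W) (α γ : Fin p)
    (i j k : Fin n) : dv k γ (D.curlU α i j) z = 0 := by
  have hd : ∀ i j, DifferentiableAt ℝ (dx j (D.U α i)) z := fun i j =>
    hD.differentiableAt (hD.contDiffOn_dx (hD.contDiffOn_U α i) j) hz
  have h0 : ∀ i j, dv k γ (dx j (D.U α i)) z = 0 := by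
    intro i j
    rw [hD.dv_dx_comm hz (hD.contDiffOn_U α i)]
    exact along_eq_zero (V := fun _ => vecSpace j) hD.isOpen (fun w hw => hD.dv_U hw α γ i k) hz
  have h1 : dv k γ (D.curlU α i j) z = dv k γ (dx j (D.U α i)) z - dv k γ (dx i (D.U α j)) z :=
    along_sub (V := fun _ => vecFibre k γ) (hd i j) (hd j i)
  rw [h1, h0, h0, sub_zero]

theorem along_F_eq_curlU (hD : D.IsKroneckerOn V W) (hp : 2 ≤ p) (hz : z ∈ jetRegion V W)
    (α : Fin p) (i j : Fin n) (Y : Coord p n → Coord p n) :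
    along Y (D.F α i j) z = - (1 / 4) * along Y (D.curlU α i j) z := by
  rw [along_congr hD.isOpen (fun w hw => hD.F_eq_curlU hp hw α i j) hz,
    along_const_mul _ (hD.differentiableAt (hD.contDiffOn_curlU α i j) hz)]

theorem maxwell_second_several (hD : D.IsKroneckerOn V W) (hp : 2 ≤ p) (hz : z ∈ jetRegion V W)
    (α : Fin p) (i j k : Fin n) :
    cyclicSum (fun i j k => D.covX₂ D.F α i j k z) i j k = 0 := by
  have hd : ∀ i j, DifferentiableAt ℝ (dx j (D.U α i)) z := fun i j =>
    hD.differentiableAt (hD.contDiffOn_dx (hD.contDiffOn_U α i) j) hz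
  have hF : ∀ i j k, D.deltaX k (D.F α i j) z
      = - (1 / 4) * (dx k (dx j (D.U α i)) z - dx k (dx i (D.U α j)) z) := by
    intro i j k
    rw [deltaX_eq_along, hD.along_F_eq_curlU hp hz, ← D.deltaX_eq_along, deltaX]
    simp only [hD.dv_curlU hz, mul_zero, Finset.sum_const_zero, sub_zero]
    congr 1
    exact along_sub (V := fun _ => vecSpace k) (hd i j) (hd j i)
  have hs : ∀ i j k, dx k (dx j (D.U α i)) z = dx j (dx k (D.U α i)) z := fun i j k =>
    hD.dx_dx_comm hz (hD.contDiffOn_U α i) k j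
  rw [hD.cyclicSum_covX₂_F hz]
  simp only [cyclicSum, hF]
  linarith [hs i j k, hs j k i, hs k i j]

theorem maxwell_third_several (hD : D.IsKroneckerOn V W) (hp : 2 ≤ p) (hz : z ∈ jetRegion V W)
    (α γ : Fin p) (i j k : Fin n) :
    cyclicSum (fun i j k => D.covV₂ D.F α i j γ k z) i j k = 0 := by
  have hF : ∀ i j k, dv k γ (D.F α i j) z = 0 := by
    intro i j k
    rw [dv_eq_along, hD.along_F_eq_curlU hp hz, ← dv_eq_along, hD.dv_curlU hz, mul_zero]
  rw [cyclicSum_covV₂_F fun i j k => hD.cC_symm hz γ i j k]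
  simp [cyclicSum, hF]

end SeveralTimes
end LocalData.IsKroneckerOn

section Charts

variable {m : ℕ} {N : Type*} [TopologicalSpace N] [ChartedSpace (EuclideanSpace ℝ (Fin m)) N]
  {φ : OpenPartialHomeomorph N (EuclideanSpace ℝ (Fin m))}

/-! ### Local expressions of a metrical multi-time Lagrange space -/

theorem bijective_mfderiv_symm (hφ : φ ∈ IsManifold.maximalAtlas (𝓡 m) ∞ N)
    {u : EuclideanSpace ℝ (Fin m)} (hu : u ∈ φ.target) :
    Function.Bijective (mfderiv (𝓡 m) (𝓡 m) φ.symm u) := by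
  have hd : φ.MDifferentiable (𝓡 m) (𝓡 m) :=
    ⟨(contMDiffOn_of_mem_maximalAtlas hφ).mdifferentiableOn (by simp),
      (contMDiffOn_symm_of_mem_maximalAtlas hφ).mdifferentiableOn (by simp)⟩
  exact hd.symm.mfderiv_bijective hu

/-- The differential of an inverse chart is bijective, so the coordinate vectors form a basis and
the matrix is the Gram matrix of a nondegenerate form. -/
theorem isUnit_det_coordVec (hφ : φ ∈ IsManifold.maximalAtlas (𝓡 m) ∞ N)
    {u : EuclideanSpace ℝ (Fin m)} (hu : u ∈ φ.target)
    {B : LinearMap.BilinForm ℝ (TangentSpace (𝓡 m) (φ.symm u))} (hB : B.Nondegenerate) :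
    IsUnit (Matrix.of fun i j => B (coordVec φ u i) (coordVec φ u j)).det := by
  let e : EuclideanSpace ℝ (Fin m) ≃ₗ[ℝ] TangentSpace (𝓡 m) (φ.symm u) :=
    LinearEquiv.ofBijective (mfderiv (𝓡 m) (𝓡 m) φ.symm u).toLinearMap
      (bijective_mfderiv_symm hφ hu)
  let b : Module.Basis (Fin m) ℝ (TangentSpace (𝓡 m) (φ.symm u)) :=
    (EuclideanSpace.basisFun (Fin m) ℝ).toBasis.map e
  have hb : ∀ i, b i = coordVec φ u i := by
    intro i
    change e ((EuclideanSpace.basisFun (Fin m) ℝ).toBasis i) = _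
    rw [OrthonormalBasis.coe_toBasis, EuclideanSpace.basisFun_apply]
    rfl
  have hM : (Matrix.of fun i j => B (coordVec φ u i) (coordVec φ u j))
      = LinearMap.BilinForm.toMatrix b B := by
    ext i j
    simp [LinearMap.BilinForm.toMatrix_apply, hb]
  rw [hM, isUnit_iff_ne_zero]
  exact (LinearMap.BilinForm.nondegenerate_iff_det_ne_zero b).mp hB

end Charts

variable {p n : ℕ} {T M : Type*}
    [TopologicalSpace T] [ChartedSpace (EuclideanSpace ℝ (Fin p)) T]
    [TopologicalSpace M] [ChartedSpace (EuclideanSpace ℝ (Fin n)) M]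

/-- The bridge from manifolds to calculus: each pair of charts is treated separately, with no change
of coordinates. -/
theorem LagrangeSpace.isKroneckerOn_inCharts (S : LagrangeSpace p n T M)
    {φ : OpenPartialHomeomorph T (EuclideanSpace ℝ (Fin p))}
    (hφ : φ ∈ IsManifold.maximalAtlas (𝓡 p) ∞ T)
    {ψ : OpenPartialHomeomorph M (EuclideanSpace ℝ (Fin n))}
    (hψ : ψ ∈ IsManifold.maximalAtlas (𝓡 n) ∞ M) :
    (S.inCharts φ ψ).IsKroneckerOn φ.target ψ.target where
  isOpen_time := φ.open_target
  isOpen_space := ψ.open_target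
  L := S.L_smooth φ hφ ψ hψ
  h := S.h.smooth φ hφ
  g := S.g_smooth φ hφ ψ hψ
  g_symm := fun z _ _ _ => (S.g_symm (jetOfCoord φ ψ z)).eq _ _
  h_unit := fun u hu => isUnit_det_coordVec hφ hu (S.h.nondegenerate (φ.symm u))
  g_unit := fun z hz => isUnit_det_coordVec hψ hz.2 (S.g_nondegenerate (jetOfCoord φ ψ z))
  regular := S.regular φ hφ ψ hψ

end MultiTime
end

/-! ### The Maxwell equations in arbitrary charts -/

theorem mainTheorem1 {p n : ℕ} (hp : 1 ≤ p) {T M : Type*}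
    [TopologicalSpace T] [ChartedSpace (EuclideanSpace ℝ (Fin p)) T] [IsManifold (𝓡 p) ∞ T]
    [TopologicalSpace M] [ChartedSpace (EuclideanSpace ℝ (Fin n)) M] [IsManifold (𝓡 n) ∞ M]
    (S : MultiTime.LagrangeSpace p n T M)
    (φ : OpenPartialHomeomorph T (EuclideanSpace ℝ (Fin p)))
    (hφ : φ ∈ IsManifold.maximalAtlas (𝓡 p) ∞ T)
    (ψ : OpenPartialHomeomorph M (EuclideanSpace ℝ (Fin n)))
    (hψ : ψ ∈ IsManifold.maximalAtlas (𝓡 n) ∞ M)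
    (D : MultiTime.LocalData p n) (hD : D = S.inCharts φ ψ)
    (z : MultiTime.Coord p n) (hz : z ∈ MultiTime.jetDomain φ ψ) :
    -- first Maxwell equation
    (∀ (α β : Fin p) (i k : Fin n),
      D.covT₂ D.F α i k β z
        = 1 / 2 * (D.maxwellTerm α β i k z - D.maxwellTerm α β k i z)) ∧
    -- second Maxwell equation, for one temporal dimension and for at least two
    (p = 1 → ∀ (α : Fin p) (i j k : Fin n),
      MultiTime.cyclicSum (fun i j k => D.covX₂ D.F α i j k z) i j k
        = - MultiTime.cyclicSum (fun i j k =>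
            ∑ l, ∑ m, D.Clow α α α i l m z * D.torRX m α j k z * z.2.2 l α) i j k) ∧
    (2 ≤ p → ∀ (α : Fin p) (i j k : Fin n),
      MultiTime.cyclicSum (fun i j k => D.covX₂ D.F α i j k z) i j k = 0) ∧
    -- third Maxwell equation
    (∀ (α γ : Fin p) (i j k : Fin n),
      MultiTime.cyclicSum (fun i j k => D.covV₂ D.F α i j γ k z) i j k = 0) ∧
    -- the fully covariant form of the vertical coefficients for one temporal dimension
    (p = 1 → ∀ (α : Fin p) (i l m : Fin n),
      D.Clow α α α i l m z
        = 1 / 4 * MultiTime.dv i α (MultiTime.dv l α (MultiTime.dv m α D.L)) z) := by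
  have hK : D.IsKroneckerOn φ.target ψ.target := by
    rw [hD]; exact S.isKroneckerOn_inCharts hφ hψ
  refine ⟨hK.maxwell_first hz, ?_, fun h2 => hK.maxwell_second_several h2 hz, ?_, ?_⟩
  · intro h1 α
    subst h1
    obtain rfl : α = 0 := Subsingleton.elim _ _
    exact hK.maxwell_second_one hz
  · intro α γ
    by_cases h2 : 2 ≤ p
    · exact hK.maxwell_third_several h2 hz α γ
    · obtain rfl : p = 1 := by omega
      obtain rfl : α = 0 := Subsingleton.elim _ _
      obtain rfl : γ = 0 := Subsingleton.elim _ _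
      exact hK.maxwell_third_one hz
  · intro h1 α
    subst h1
    obtain rfl : α = 0 := Subsingleton.elim _ _
    exact hK.Clow_eq_dv hz
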